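/- **Proposition.** Let $T$ be the set of $t=(a,b,c,t_1,t_2)\in\mathbb{C}^5$ with $ab\Delta\neq 0$, where $t_3:=4a^3-t_2a-b^2$ and $\Delta:=27t_3^2-t_2^3$. For $t\in T$ let $X_t$ be the elliptic curve $y^2=4x^3-t_2x-t_3$ with point at infinity $O$ and marked point $P=(a,b)$, $Y_t=\{O,P\}$, and let $H^1_{\mathrm{dR}}(X_t,Y_t)$ have the frame $$\alpha_1=\mathrm{d}\Big(\frac{x-a}{x}\Big),\qquad \alpha_2=\frac{\mathrm{d}x}{y},\qquad \alpha_3=\Big(c-\frac{b}{2a}\Big)\mathrm{d}\Big(\frac{x-a}{x}\Big)+t_1\frac{\mathrm{d}x}{y}+\frac{x\,\mathrm{d}x}{y}-\mathrm{d}\Big(\frac{y}{2x}\Big),$$ represented by forms that are regular on $(X_t\setminus\{x=0\})\cup\{O\}$ and have no residues. The relative Gauss–Manin connection $\nabla$ is the holomorphic connection on the bundle of the $H^1_{\mathrm{dR}}(X_t,Y_t)$ over $T$ such that $\mathrm{d}\big(\int_\delta\omega\big)=\int_\delta\nabla\omega$ for every locally constant family $\delta$ of classes in $H_1(X_t,Y_t;\mathbb{Z})$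 over an open subset of $T$. Exactly one holomorphic connection matrix has this property in the frame above, and it is given by $$\nabla\begin{pmatrix}\alpha_1\\ \alpha_2\\ \alpha_3\end{pmatrix}=\frac1\Delta\begin{pmatrix}0&0&0\\ A_{21}&A_{22}&A_{23}\\ A_{31}&A_{32}&A_{33}\end{pmatrix}\otimes\begin{pmatrix}\alpha_1\\ \alpha_2\\ \alpha_3\end{pmatrix},$$ where, with $\alpha=3t_3\,\mathrm{d}t_2-2t_2\,\mathrm{d}t_3$ (and $\mathrm{d}t_3$, $\mathrm{d}\Delta$ the differentials of $t_3$ and $\Delta$ as functions on $T$), $$\begin{aligned} A_{21}&=g_1\mathrm{d}t_2+g_2\mathrm{d}t_3-\Big(c-\frac{b}{2a}\Big)\frac{3\alpha}{2}-\frac{\Delta\,\mathrm{d}a}{b},\\ A_{22}&=-\frac{3t_1\alpha}{2}-\frac{\mathrm{d}\Delta}{12},\qquad A_{23}=\frac{3\alpha}{2},\\ A_{31}&=(t_1g_1+g_3)\mathrm{d}t_2+(t_1g_2+g_1)\mathrm{d}t_3-\frac{(a+t_1)\Delta\,\mathrm{d}a}{b}-\Big(c-\frac{b}{2a}\Big)\Big(\frac{3t_1\alpha}{2}+\frac{\mathrm{d}\Delta}{12}\Big)+\Delta\,\mathrm{d}c,\\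 A_{32}&=\Delta\,\mathrm{d}t_1-\frac{t_1\,\mathrm{d}\Delta}{6}-\Big(\frac{3t_1^2}{2}+\frac{t_2}{8}\Big)\alpha,\qquad A_{33}=\frac{3t_1\alpha}{2}+\frac{\mathrm{d}\Delta}{12}, \end{aligned}$$ $$g_1=\frac{-2a^2t_2^2+3at_2t_3+9t_3^2}{4ab},\qquad g_2=\frac{18a^2t_3-at_2^2-3t_2t_3}{2ab},\qquad g_3=\frac{6a^2t_2t_3+(18t_3^2-t_2^3)a-t_2^2t_3}{8ab}.$$ -/

import Mathlib

open scoped ContDiff Topology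

noncomputable section

namespace EllipticPair

/-! The parameters: a point of `ℂ⁵` is `t = (a, b, c, t₁, t₂)`. -/

abbrev Param : Type := Fin 5 → ℂ

def a (t : Param) : ℂ := t 0
def b (t : Param) : ℂ := t 1
def c (t : Param) : ℂ := t 2
def t₁ (t : Param) : ℂ := t 3
def t₂ (t : Param) : ℂ := t 4

/-- The coefficient `t₃`, determined by the condition that `(a, b)` lies on the curve. -/
def t₃ (t : Param) : ℂ := 4 * a t ^ 3 - t₂ t * a t - b t ^ 2

/-- The discriminant `Δ = 27 t₃² - t₂³`. -/
def disc (t : Param) : ℂ := 27 * t₃ t ^ 2 - t₂ t ^ 3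

/-- The parameters of smooth curves (`Δ ≠ 0`) at which the frame and the entries of the connection
matrix, whose denominators are `a`, `b` and `Δ`, are defined. -/
def Base : Set Param := {t | a t ≠ 0 ∧ b t ≠ 0 ∧ disc t ≠ 0}

/-! ### The curve and its two marked points

`X` is the projective curve `y² = 4x³ - t₂x - t₃`. Its open subset `U = (X ∖ {x = 0}) ∪ {O}`, on
which the forms of the frame are regular, is affine: in the coordinates `u = 1/x`, `v = y/x²` it is
the plane curve `v² = 4u - t₂u³ - t₃u⁴`. The point at infinity `O` is `(u, v) = (0, 0)`, and
`P = (a, b)` is `(u, v) = (1/a, b/a²)`. -/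

def quartic (t : Param) (u : ℂ) : ℂ := 4 * u - t₂ t * u ^ 3 - t₃ t * u ^ 4

/-- The derivative of `quartic t`. -/
def quarticDeriv (t : Param) (u : ℂ) : ℂ := 4 - 3 * t₂ t * u ^ 2 - 4 * t₃ t * u ^ 3

def Curve (t : Param) : Set (ℂ × ℂ) := {p | p.2 ^ 2 = quartic t p.1}

def ptO : ℂ × ℂ := (0, 0)

def ptP (t : Param) : ℂ × ℂ := (1 / a t, b t / a t ^ 2)

/-! ### The frame

A differential form on `U` is written as a function of a point `p = (u, v)` and a tangent vector
`w = (du, dv)` of `U` at `p`. -/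

/-- The regular form `du/v = 2dv/q'(u)` on the smooth curve `v² = q(u)`. -/
def duOverV (t : Param) (p w : ℂ × ℂ) : ℂ :=
  if p.2 = 0 then 2 * w.2 / quarticDeriv t p.1 else w.1 / p.2

/-- `ω₁ = d((x - a)/x) = d(1 - a u)`. -/
def ω₁ (t : Param) (_p w : ℂ × ℂ) : ℂ := -(a t) * w.1

/-- `ω₂ = dx/y = -du/v`. -/
def ω₂ (t : Param) (p w : ℂ × ℂ) : ℂ := -duOverV t p w

/-- `ω₃ = x dx/y - d(y/(2x))`, which is regular on `U` and equal to
`(t₂ u/4 + t₃ u²/2) du/v`; see `omega_eq`. -/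
def ω₃ (t : Param) (p w : ℂ × ℂ) : ℂ :=
  (t₂ t * p.1 / 4 + t₃ t * p.1 ^ 2 / 2) * duOverV t p w

/-- The frame `α₁ = ω₁`, `α₂ = ω₂`, `α₃ = (c - b/(2a)) ω₁ + t₁ ω₂ + ω₃`. -/
def frame (i : Fin 3) (t : Param) (p w : ℂ × ℂ) : ℂ :=
  ![ω₁ t p w, ω₂ t p w,
    (c t - b t / (2 * a t)) * ω₁ t p w + t₁ t * ω₂ t p w + ω₃ t p w] i

/-! ### Relative cycles and periods -/

/-- A locally constant family of relative cycles of the pairs `(X_t, {O, P})`, `t ∈ W`, represented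
by paths in `U_t` that depend smoothly on `t`: each is a closed path or has both its end points in
`{O, P}`. The classes of such paths generate `H₁(X_t, {O, P}; ℤ)`. -/
def IsCycleFamily (W : Set Param) (γ : Param → ℝ → ℂ × ℂ) : Prop :=
  ContDiffOn ℝ ∞ (fun z : Param × ℝ => γ z.1 z.2) (W ×ˢ Set.univ) ∧
  (∀ t ∈ W, ∀ s ∈ Set.Icc (0 : ℝ) 1, γ t s ∈ Curve t) ∧
  ((∀ t ∈ W, γ t 0 = γ t 1) ∨
    (((∀ t ∈ W, γ t 0 = ptO) ∨ (∀ t ∈ W, γ t 0 = ptP t)) ∧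
      ((∀ t ∈ W, γ t 1 = ptO) ∨ (∀ t ∈ W, γ t 1 = ptP t))))

/-- The period `∫_{γ_t} α_i`. -/
def period (i : Fin 3) (γ : Param → ℝ → ℂ × ℂ) (t : Param) : ℂ :=
  ∫ s in (0 : ℝ)..1, frame i t (γ t s) (deriv (γ t) s)

/-- `A` is the matrix, in the frame `α₁, α₂, α₃`, of a holomorphic connection
`∇ α_i = ∑ j, A_ij ⊗ α_j` on the bundle of the `H¹_dR(X_t, {O, P})`, `t ∈ Base`, with the
property that characterises the relative Gauss-Manin connection: `d (∫_δ α_i) = ∫_δ ∇ α_i` for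
every locally constant family `δ` of relative cycles. (By the Leibniz rule the property then holds
for all sections `∑ i, f_i α_i`.) -/
def IsGaussManinMatrix (A : Param → Matrix (Fin 3) (Fin 3) (Param →L[ℂ] ℂ)) : Prop :=
  (∀ i j, DifferentiableOn ℂ (fun t => A t i j) Base) ∧
  ∀ W : Set Param, IsOpen W → W ⊆ Base → ∀ γ : Param → ℝ → ℂ × ℂ, IsCycleFamily W γ →
    ∀ t ∈ W, ∀ i, HasFDerivAt (period i γ) (∑ j, period j γ t • A t i j) t

/-! ### The explicit matrix -/

def da : Param →L[ℂ] ℂ := ContinuousLinearMap.proj 0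
def dc : Param →L[ℂ] ℂ := ContinuousLinearMap.proj 2
def dt₁ : Param →L[ℂ] ℂ := ContinuousLinearMap.proj 3
def dt₂ : Param →L[ℂ] ℂ := ContinuousLinearMap.proj 4
def dt₃ (t : Param) : Param →L[ℂ] ℂ := fderiv ℂ t₃ t
def dDisc (t : Param) : Param →L[ℂ] ℂ := fderiv ℂ disc t

/-- The 1-form `α = 3 t₃ dt₂ - 2 t₂ dt₃`. -/
def α (t : Param) : Param →L[ℂ] ℂ := (3 * t₃ t) • dt₂ - (2 * t₂ t) • dt₃ t

def g₁ (t : Param) : ℂ :=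
  (-2 * a t ^ 2 * t₂ t ^ 2 + 3 * a t * t₂ t * t₃ t + 9 * t₃ t ^ 2) / (4 * a t * b t)

def g₂ (t : Param) : ℂ :=
  (18 * a t ^ 2 * t₃ t - a t * t₂ t ^ 2 - 3 * t₂ t * t₃ t) / (2 * a t * b t)

def g₃ (t : Param) : ℂ :=
  (6 * a t ^ 2 * t₂ t * t₃ t + (18 * t₃ t ^ 2 - t₂ t ^ 3) * a t - t₂ t ^ 2 * t₃ t) /
    (8 * a t * b t)

def A₂₁ (t : Param) : Param →L[ℂ] ℂ :=
  g₁ t • dt₂ + g₂ t • dt₃ t - ((c t - b t / (2 * a t)) * (3 / 2)) • α t - (disc t / b t) • da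

def A₂₂ (t : Param) : Param →L[ℂ] ℂ :=
  -((3 * t₁ t / 2) • α t) - (1 / 12 : ℂ) • dDisc t

def A₂₃ (t : Param) : Param →L[ℂ] ℂ := (3 / 2 : ℂ) • α t

def A₃₁ (t : Param) : Param →L[ℂ] ℂ :=
  (t₁ t * g₁ t + g₃ t) • dt₂ + (t₁ t * g₂ t + g₁ t) • dt₃ t
    - ((a t + t₁ t) * disc t / b t) • da
    - (c t - b t / (2 * a t)) • ((3 * t₁ t / 2) • α t + (1 / 12 : ℂ) • dDisc t)
    + disc t • dc

def A₃₂ (t : Param) : Param →L[ℂ] ℂ :=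
  disc t • dt₁ - (t₁ t / 6) • dDisc t - (3 * t₁ t ^ 2 / 2 + t₂ t / 8) • α t

def A₃₃ (t : Param) : Param →L[ℂ] ℂ :=
  (3 * t₁ t / 2) • α t + (1 / 12 : ℂ) • dDisc t

def explicitMatrix (t : Param) : Matrix (Fin 3) (Fin 3) (Param →L[ℂ] ℂ) :=
  (disc t)⁻¹ •
    !![0, 0, 0;
       A₂₁ t, A₂₂ t, A₂₃ t;
       A₃₁ t, A₃₂ t, A₃₃ t]

/-! ### The chart and the forms in the coordinates `x = 1/u`, `y = v/u²` -/

theorem mem_curve_iff (t : Param) {u v : ℂ} (hu : u ≠ 0) :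
    (u, v) ∈ Curve t ↔ (v / u ^ 2) ^ 2 = 4 * (1 / u) ^ 3 - t₂ t * (1 / u) - t₃ t := by
  simp only [Curve, quartic, Set.mem_ofPred_eq]
  constructor
  · intro h
    field_simp
    linear_combination h
  · intro h
    field_simp at h
    linear_combination h

theorem ptO_mem (t : Param) : ptO ∈ Curve t := by
  simp [Curve, ptO, quartic]

theorem ptP_mem {t : Param} (ht : t ∈ Base) : ptP t ∈ Curve t := by
  have ha : a t ≠ 0 := ht.1
  simp only [Curve, ptP, quartic, t₃, Set.mem_ofPred_eq]
  field_simp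
  ring

theorem quartic_hasDerivAt (t : Param) (u : ℂ) :
    HasDerivAt (quartic t) (quarticDeriv t u) u := by
  have h := (((hasDerivAt_id u).const_mul 4).sub (((hasDerivAt_id u).pow 3).const_mul (t₂ t))).sub
    (((hasDerivAt_id u).pow 4).const_mul (t₃ t))
  refine (h.congr_deriv ?_)
  simp [quarticDeriv]
  ring

/-- Along a path in the curve and away from `O` and the points with `y = 0`, the forms are
`d((x - a)/x)`, `dx/y` and `x dx/y - d(y/(2x))`. -/
theorem omega_eq (t : Param) (x y : ℝ → ℂ) (x' y' : ℂ) (s : ℝ)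
    (hx : HasDerivAt x x' s) (hy : HasDerivAt y y' s) (hx0 : x s ≠ 0) (hy0 : y s ≠ 0)
    (hxy : ∀ᶠ r in 𝓝 s, y r ^ 2 = 4 * x r ^ 3 - t₂ t * x r - t₃ t) :
    let γ : ℝ → ℂ × ℂ := fun r => (1 / x r, y r / x r ^ 2)
    ω₁ t (γ s) (deriv γ s) = deriv (fun r => (x r - a t) / x r) s ∧
    ω₂ t (γ s) (deriv γ s) = x' / y s ∧
    ω₃ t (γ s) (deriv γ s) = x s * x' / y s - deriv (fun r => y r / (2 * x r)) s := by
  intro γ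
  have hu := (hasDerivAt_const s (1 : ℂ)).fun_div hx hx0
  have hv := hy.fun_div (hx.fun_pow 2) (pow_ne_zero 2 hx0)
  have hγ : deriv γ s = _ := (hu.prodMk hv).deriv
  have h1 := ((hx.sub_const (a t)).fun_div hx hx0).deriv
  have h3 := (hy.fun_div (hx.const_mul 2) (mul_ne_zero two_ne_zero hx0)).deriv
  have he : 2 * y s * y' = (12 * x s ^ 2 - t₂ t) * x' := by
    have e1 := hy.fun_pow 2
    have e2 := (((hx.fun_pow 3).const_mul 4).fun_sub (hx.const_mul (t₂ t))).sub_const (t₃ t)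
    have e3 := e1.unique (e2.congr_of_eventuallyEq hxy)
    push_cast at e3
    linear_combination e3
  have hc : y s ^ 2 = 4 * x s ^ 3 - t₂ t * x s - t₃ t := hxy.self_of_nhds
  have hv0 : y s / x s ^ 2 ≠ 0 := div_ne_zero hy0 (pow_ne_zero 2 hx0)
  rw [hγ, h1, h3]
  refine ⟨?_, ?_, ?_⟩
  · simp only [ω₁]
    field_simp
    ring
  · simp only [ω₂, duOverV, γ, if_neg hv0]
    field_simp
    ring
  · simp only [ω₃, duOverV, γ, if_neg hv0]
    field_simp
    linear_combination (2 * x s) * he - 4 * x' * hc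

end EllipticPair

end

/-!
On the curve `v² = q(u)` the form `du/v` pulled back to a path `(U, V)` is the number `θ`
determined by `V θ = U'` and `q'(U) θ = 2 V'`. Since `A q + B q' = 1` for polynomials `A`, `B`
whose denominators divide `Δ` (`bezout`), it equals `A V U' + 2 B V'`, which is smooth also where
`V = 0`.

**The connection.** The variation of `q` in a direction `τ` of the parameters is `M q + N q'` with
polynomials `M`, `N` in `u` (`reduction`). Differentiating the equations for `θ` gives `∂_τ θ =
-(M/2 + N') θ + ∂_s G`, where `G = (U_τ + N)/V` is again regular at the points with `V = 0`
(`dirDeriv_theta`). Reducing the polynomials `M/2 + N'` and its analogue for `ω₃ = h(u) du/v`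
modulo the exact forms `d(r v)` gives the derivatives of the integrals of `ω₂` and `ω₃` over a
smooth family of paths, up to boundary terms (`IsCurveFamily.hasFDerivAt_theta`,
`IsCurveFamily.hasFDerivAt_weight_mul_theta`). The boundary terms cancel for closed paths and
vanish at `O`; at `P` they are the contributions to the first column of the matrix
(`contraction_at_P`, `boundary_at_P`). The derivatives found in this way are complex linear, so
the periods are holomorphic although the families of paths are only smooth.

**Uniqueness.** The difference of two Gauss-Manin matrices annihilates all period vectors, so it
suffices to produce enough cycles. Let `e`, `f`, `g` be the roots of `4x³ - t₂x - t₃`, in the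
order of decreasing modulus. The segments from `0` to `1/e` and to `1/f` avoid the other branch
points and lift to two loops through `O`. The Gauss-Manin matrix of the closed periods has trace
zero, so the determinant of the periods of `ω₂`, `ω₃` over the two loops does not change when
`f/e` moves to `-1` along a segment (`hasDerivAt_loopDet`); for `f = -e` it is a nonzero multiple
of a product of two integrals of positive functions (`loopDet_lemniscatic_ne_zero`). This
determines two columns. For the first column a path from `O` to `P` is needed. The segment from
`0` to `1/a` lifts to one unless it contains a branch point, which an arbitrarily small rotation
of `a` with `t₂`, `t₃` fixed avoids; the remaining parameters follow by continuity of the entries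
(`column_zero_eq`).
-/

noncomputable section

namespace EllipticPair

/-! ### Bézout identities for the quartic -/

/-- The quartic `q(u) = 4u - p₂u³ - p₃u⁴`, as a function of its coefficients. -/
def quarticOf (p₂ p₃ u : ℂ) : ℂ := 4 * u - p₂ * u ^ 3 - p₃ * u ^ 4

/-- The derivative `q'(u)` of `quarticOf`. -/
def quarticDerivOf (p₂ p₃ u : ℂ) : ℂ := 4 - 3 * p₂ * u ^ 2 - 4 * p₃ * u ^ 3

/-- The discriminant `Δ = 27 p₃² - p₂³`. -/
def discOf (p₂ p₃ : ℂ) : ℂ := 27 * p₃ ^ 2 - p₂ ^ 3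

/-- The polynomial `M` of the reduction `q_τ = M q + N q'`; see `reduction`. -/
def redM (p₂ p₃ τ₂ τ₃ u : ℂ) : ℂ :=
  -(τ₂ * (-p₂ ^ 2 / 2 + 3 * p₂ * p₃ * u / 4 + 9 * p₃ ^ 2 * u ^ 2) +
    τ₃ * (9 * p₃ - p₂ ^ 2 * u / 2 - 6 * p₂ * p₃ * u ^ 2)) / discOf p₂ p₃

/-- The polynomial `N` of the reduction `q_τ = M q + N q'`; see `reduction`. -/
def redN (p₂ p₃ τ₂ τ₃ u : ℂ) : ℂ :=
  (τ₂ * (-p₂ ^ 2 * u / 2 + 3 * p₂ * p₃ * u ^ 2 / 4 + 9 * p₃ ^ 2 * u ^ 3 / 4) +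
    τ₃ * (9 * p₃ * u - p₂ ^ 2 * u ^ 2 / 2 - 3 * p₂ * p₃ * u ^ 3 / 2)) / discOf p₂ p₃

/-- The derivative of `redM` with respect to `u`. -/
def redMDeriv (p₂ p₃ τ₂ τ₃ u : ℂ) : ℂ :=
  -(τ₂ * (3 * p₂ * p₃ / 4 + 18 * p₃ ^ 2 * u) +
    τ₃ * (-p₂ ^ 2 / 2 - 12 * p₂ * p₃ * u)) / discOf p₂ p₃

/-- The derivative of `redN` with respect to `u`. -/
def redNDeriv (p₂ p₃ τ₂ τ₃ u : ℂ) : ℂ :=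
  (τ₂ * (-p₂ ^ 2 / 2 + 3 * p₂ * p₃ * u / 2 + 27 * p₃ ^ 2 * u ^ 2 / 4) +
    τ₃ * (9 * p₃ - p₂ ^ 2 * u - 9 * p₂ * p₃ * u ^ 2 / 2)) / discOf p₂ p₃

/-- The variation `-τ₂u³ - τ₃u⁴` of the quartic in the direction `(τ₂, τ₃)` lies in the ideal
generated by `q` and `q'`. The factor `N` vanishes at `u = 0`, so that the vector field `-N ∂/∂u`
fixes the branch point `O`. -/
theorem reduction {p₂ p₃ : ℂ} (h : discOf p₂ p₃ ≠ 0) (τ₂ τ₃ u : ℂ) :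
    -τ₂ * u ^ 3 - τ₃ * u ^ 4 =
      redM p₂ p₃ τ₂ τ₃ u * quarticOf p₂ p₃ u + redN p₂ p₃ τ₂ τ₃ u * quarticDerivOf p₂ p₃ u := by
  rw [redM, redN]
  field_simp
  rw [discOf, quarticOf, quarticDerivOf]
  ring

/-- The derivative with respect to `u` of the identity `reduction`. -/
theorem reduction_deriv {p₂ p₃ : ℂ} (h : discOf p₂ p₃ ≠ 0) (τ₂ τ₃ u : ℂ) :
    -3 * τ₂ * u ^ 2 - 4 * τ₃ * u ^ 3 =
      redMDeriv p₂ p₃ τ₂ τ₃ u * quarticOf p₂ p₃ u +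
      redM p₂ p₃ τ₂ τ₃ u * quarticDerivOf p₂ p₃ u +
      redNDeriv p₂ p₃ τ₂ τ₃ u * quarticDerivOf p₂ p₃ u -
      redN p₂ p₃ τ₂ τ₃ u * (6 * p₂ * u + 12 * p₃ * u ^ 2) := by
  rw [redM, redN, redMDeriv, redNDeriv]
  field_simp
  rw [discOf, quarticOf, quarticDerivOf]
  ring

/-- The coefficient of `q` in a Bézout identity for `q` and `q'`. -/
def bezoutA (p₂ p₃ u : ℂ) : ℂ :=
  (3 * p₂ * u - 16 * p₃ * redM p₂ p₃ 1 0 u -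
    (3 * p₂ ^ 2 + 3 * p₂ * p₃ * u) * redM p₂ p₃ 0 1 u) / 16

/-- The coefficient of `q'` in a Bézout identity for `q` and `q'`. -/
def bezoutB (p₂ p₃ u : ℂ) : ℂ :=
  (4 - 16 * p₃ * redN p₂ p₃ 1 0 u -
    (3 * p₂ ^ 2 + 3 * p₂ * p₃ * u) * redN p₂ p₃ 0 1 u) / 16

theorem bezout {p₂ p₃ : ℂ} (h : discOf p₂ p₃ ≠ 0) (u : ℂ) :
    bezoutA p₂ p₃ u * quarticOf p₂ p₃ u + bezoutB p₂ p₃ u * quarticDerivOf p₂ p₃ u = 1 := by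
  have h3 := reduction h 1 0 u
  have h4 := reduction h 0 1 u
  have e : (3 * p₂ * u * quarticOf p₂ p₃ u + 4 * quarticDerivOf p₂ p₃ u) / 16 + p₃ * u ^ 3 +
      (3 * p₂ ^ 2 + 3 * p₂ * p₃ * u) / 16 * u ^ 4 = 1 := by
    rw [quarticOf, quarticDerivOf]; ring
  rw [bezoutA, bezoutB]
  linear_combination e + p₃ * h3 + (3 * p₂ ^ 2 + 3 * p₂ * p₃ * u) / 16 * h4

/-- The polynomial `h(u) = p₂u/4 + p₃u²/2` with `ω₃ = h(u) du/v`. -/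
def weight (p₂ p₃ u : ℂ) : ℂ := p₂ * u / 4 + p₃ * u ^ 2 / 2

/-- The 1-form `α = 3 p₃ dp₂ - 2 p₂ dp₃` on the direction `(τ₂, τ₃)`. -/
def alphaOf (p₂ p₃ τ₂ τ₃ : ℂ) : ℂ := 3 * p₃ * τ₂ - 2 * p₂ * τ₃

/-- The differential of `discOf` in the direction `(τ₂, τ₃)`. -/
def discDerivOf (p₂ p₃ τ₂ τ₃ : ℂ) : ℂ := 54 * p₃ * τ₃ - 3 * p₂ ^ 2 * τ₂

/-- The polynomial `r(u)` for which `d(r v)` is the exact part in the derivative of `ω₃`. -/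
def exactR (p₂ p₃ τ₂ τ₃ u : ℂ) : ℂ :=
  alphaOf p₂ p₃ τ₂ τ₃ * (-p₂ / 16 + 3 * p₃ * u / 8) / discOf p₂ p₃

/-- The multiplier `-(M/2 + N')` in the derivative of `du/v` is a combination of `1` and the weight
`h`, without an exact correction. -/
theorem reduction_one {p₂ p₃ : ℂ} (h : discOf p₂ p₃ ≠ 0) (τ₂ τ₃ u : ℂ) :
    -(redM p₂ p₃ τ₂ τ₃ u / 2 + redNDeriv p₂ p₃ τ₂ τ₃ u) =
      (-(discDerivOf p₂ p₃ τ₂ τ₃ / 12) -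
        3 / 2 * alphaOf p₂ p₃ τ₂ τ₃ * weight p₂ p₃ u) / discOf p₂ p₃ := by
  rw [redM, redNDeriv, alphaOf, discDerivOf, weight]
  field_simp
  ring

/-- The multiplier in the derivative of `h du/v` is a combination of `1` and `h` up to the term
`r' q + r q'/2`, which is the coefficient of the exact form `d(r v)`. -/
theorem reduction_weight {p₂ p₃ : ℂ} (h : discOf p₂ p₃ ≠ 0) (τ₂ τ₃ u : ℂ) :
    weight τ₂ τ₃ u - (p₂ / 4 + p₃ * u) * redN p₂ p₃ τ₂ τ₃ u
      - weight p₂ p₃ u * (redM p₂ p₃ τ₂ τ₃ u / 2 + redNDeriv p₂ p₃ τ₂ τ₃ u) =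
      (p₂ / 8 * alphaOf p₂ p₃ τ₂ τ₃ +
        discDerivOf p₂ p₃ τ₂ τ₃ / 12 * weight p₂ p₃ u) / discOf p₂ p₃ +
      (alphaOf p₂ p₃ τ₂ τ₃ * (3 * p₃ / 8) / discOf p₂ p₃ * quarticOf p₂ p₃ u +
        exactR p₂ p₃ τ₂ τ₃ u * quarticDerivOf p₂ p₃ u / 2) := by
  rw [redM, redN, redNDeriv, exactR]
  field_simp
  rw [alphaOf, discDerivOf, weight, weight, quarticOf, quarticDerivOf, discOf]
  ring

/-! ### The derivative of `du/v` along a family of paths -/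

section DirDeriv

variable {H : Type*} [NormedAddCommGroup H] [NormedSpace ℝ H]

/-- The derivative of `f` in the direction `w`, as a function of the point. -/
def dirDeriv (w : H) (f : H → ℂ) (z : H) : ℂ := fderiv ℝ f z w

theorem dirDeriv_add {w z : H} {f g : H → ℂ} (hf : DifferentiableAt ℝ f z)
    (hg : DifferentiableAt ℝ g z) :
    dirDeriv w (fun z => f z + g z) z = dirDeriv w f z + dirDeriv w g z := by
  simp [dirDeriv, fderiv_fun_add hf hg]

theorem dirDeriv_sub {w z : H} {f g : H → ℂ} (hf : DifferentiableAt ℝ f z)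
    (hg : DifferentiableAt ℝ g z) :
    dirDeriv w (fun z => f z - g z) z = dirDeriv w f z - dirDeriv w g z := by
  simp [dirDeriv, fderiv_fun_sub hf hg]

theorem dirDeriv_neg {w z : H} {f : H → ℂ} :
    dirDeriv w (fun z => -f z) z = -dirDeriv w f z := by
  simp [dirDeriv, fderiv_fun_neg]

theorem dirDeriv_mul {w z : H} {f g : H → ℂ} (hf : DifferentiableAt ℝ f z)
    (hg : DifferentiableAt ℝ g z) :
    dirDeriv w (fun z => f z * g z) z = f z * dirDeriv w g z + g z * dirDeriv w f z := by
  simp [dirDeriv, fderiv_fun_mul hf hg]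

theorem dirDeriv_pow {w z : H} {f : H → ℂ} (hf : DifferentiableAt ℝ f z) (n : ℕ) :
    dirDeriv w (fun z => f z ^ n) z = n * f z ^ (n - 1) * dirDeriv w f z := by
  simp [dirDeriv, fderiv_fun_pow n hf]

theorem dirDeriv_const {w z : H} (k : ℂ) : dirDeriv w (fun _ => k) z = 0 := by
  simp [dirDeriv]

theorem dirDeriv_div {w z : H} {f g : H → ℂ} (hf : DifferentiableAt ℝ f z)
    (hg : DifferentiableAt ℝ g z) (h0 : g z ≠ 0) :
    dirDeriv w (fun z => f z / g z) z =
      (g z * dirDeriv w f z - f z * dirDeriv w g z) / g z ^ 2 := by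
  simp only [div_eq_mul_inv]
  have hi : HasFDerivAt (fun z => (g z)⁻¹) _ z :=
    ((hasDerivAt_inv h0).hasFDerivAt.restrictScalars ℝ).comp z hg.hasFDerivAt
  simp only [dirDeriv]
  rw [fderiv_fun_mul hf hi.differentiableAt, hi.fderiv]
  simp
  field_simp
  ring

theorem dirDeriv_congr {w z : H} {f g : H → ℂ} (h : f =ᶠ[𝓝 z] g) :
    dirDeriv w f z = dirDeriv w g z := by
  simp only [dirDeriv, h.fderiv_eq]

theorem contDiffOn_dirDeriv {Ω : Set H} (hΩ : IsOpen Ω) {f : H → ℂ} (hf : ContDiffOn ℝ ∞ f Ω)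
    (w : H) : ContDiffOn ℝ ∞ (dirDeriv w f) Ω :=
  (hf.fderiv_of_isOpen hΩ (by simp)).clm_apply contDiffOn_const

theorem dirDeriv_comm {Ω : Set H} (hΩ : IsOpen Ω) {f : H → ℂ} (hf : ContDiffOn ℝ ∞ f Ω)
    (v w : H) {z : H} (hz : z ∈ Ω) :
    dirDeriv v (dirDeriv w f) z = dirDeriv w (dirDeriv v f) z := by
  have hd : DifferentiableAt ℝ (fderiv ℝ f) z :=
    ((hf.fderiv_of_isOpen (m := ∞) hΩ (by simp)).contDiffAt (hΩ.mem_nhds hz)).differentiableAt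
      (by simp)
  have hs := (hf.contDiffAt (hΩ.mem_nhds hz)).isSymmSndFDerivAt
    (by simpa using WithTop.coe_le_coe.2 (le_top : (2 : ℕ∞) ≤ ⊤)) v w
  have e : ∀ a b : H, dirDeriv a (dirDeriv b f) z = fderiv ℝ (fderiv ℝ f) z a b := by
    intro a b
    unfold dirDeriv
    rw [fderiv_clm_apply hd (differentiableAt_const b)]
    simp
  rw [e, e, hs]

theorem contDiffOn_discOf {Ω : Set H} {f g : H → ℂ} (hf : ContDiffOn ℝ ∞ f Ω)
    (hg : ContDiffOn ℝ ∞ g Ω) : ContDiffOn ℝ ∞ (fun z => discOf (f z) (g z)) Ω := by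
  unfold discOf; fun_prop

theorem contDiffOn_redM {Ω : Set H} {f g f' g' u : H → ℂ} (hf : ContDiffOn ℝ ∞ f Ω)
    (hg : ContDiffOn ℝ ∞ g Ω) (hf' : ContDiffOn ℝ ∞ f' Ω) (hg' : ContDiffOn ℝ ∞ g' Ω)
    (hu : ContDiffOn ℝ ∞ u Ω) (h0 : ∀ z ∈ Ω, discOf (f z) (g z) ≠ 0) :
    ContDiffOn ℝ ∞ (fun z => redM (f z) (g z) (f' z) (g' z) (u z)) Ω := by
  unfold redM
  have hi := (contDiffOn_discOf hf hg).inv h0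
  simp only [div_eq_mul_inv]
  refine ContDiffOn.mul ?_ hi
  fun_prop

theorem contDiffOn_redN {Ω : Set H} {f g f' g' u : H → ℂ} (hf : ContDiffOn ℝ ∞ f Ω)
    (hg : ContDiffOn ℝ ∞ g Ω) (hf' : ContDiffOn ℝ ∞ f' Ω) (hg' : ContDiffOn ℝ ∞ g' Ω)
    (hu : ContDiffOn ℝ ∞ u Ω) (h0 : ∀ z ∈ Ω, discOf (f z) (g z) ≠ 0) :
    ContDiffOn ℝ ∞ (fun z => redN (f z) (g z) (f' z) (g' z) (u z)) Ω := by
  unfold redN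
  have hi := (contDiffOn_discOf hf hg).inv h0
  simp only [div_eq_mul_inv]
  refine ContDiffOn.mul ?_ hi
  fun_prop

theorem contDiffOn_bezoutA {Ω : Set H} {f g u : H → ℂ} (hf : ContDiffOn ℝ ∞ f Ω)
    (hg : ContDiffOn ℝ ∞ g Ω) (hu : ContDiffOn ℝ ∞ u Ω)
    (h0 : ∀ z ∈ Ω, discOf (f z) (g z) ≠ 0) :
    ContDiffOn ℝ ∞ (fun z => bezoutA (f z) (g z) (u z)) Ω := by
  have h1 := contDiffOn_redM hf hg (contDiffOn_const (c := 1)) (contDiffOn_const (c := 0)) hu h0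
  have h2 := contDiffOn_redM hf hg (contDiffOn_const (c := 0)) (contDiffOn_const (c := 1)) hu h0
  unfold bezoutA
  fun_prop

theorem contDiffOn_bezoutB {Ω : Set H} {f g u : H → ℂ} (hf : ContDiffOn ℝ ∞ f Ω)
    (hg : ContDiffOn ℝ ∞ g Ω) (hu : ContDiffOn ℝ ∞ u Ω)
    (h0 : ∀ z ∈ Ω, discOf (f z) (g z) ≠ 0) :
    ContDiffOn ℝ ∞ (fun z => bezoutB (f z) (g z) (u z)) Ω := by
  have h1 := contDiffOn_redN hf hg (contDiffOn_const (c := 1)) (contDiffOn_const (c := 0)) hu h0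
  have h2 := contDiffOn_redN hf hg (contDiffOn_const (c := 0)) (contDiffOn_const (c := 1)) hu h0
  unfold bezoutB
  fun_prop

/-- The form `du/v` on the tangent vector `(U_σ, V_σ)`, in the expression
`A v du + 2 B dv` that is regular at the points with `v = 0` (where `A q + B q' = 1`). -/
def theta (σ : H) (P Q U V : H → ℂ) (z : H) : ℂ :=
  bezoutA (P z) (Q z) (U z) * V z * dirDeriv σ U z +
    2 * bezoutB (P z) (Q z) (U z) * dirDeriv σ V z

/-- The function `(U_τ + N)/V`, in an expression that is regular at the points with `V = 0`: the
contraction of `du/v` with the difference between the velocity of the family and the vector field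
given by the reduction `q_τ = M q + N q'`. -/
def contraction (τ : H) (P Q U V : H → ℂ) (z : H) : ℂ :=
  bezoutA (P z) (Q z) (U z) * V z *
      (dirDeriv τ U z + redN (P z) (Q z) (dirDeriv τ P z) (dirDeriv τ Q z) (U z)) +
    bezoutB (P z) (Q z) (U z) *
      (2 * dirDeriv τ V z - redM (P z) (Q z) (dirDeriv τ P z) (dirDeriv τ Q z) (U z) * V z)

theorem contDiffOn_theta {Ω : Set H} (hΩ : IsOpen Ω) {P Q U V : H → ℂ} (hP : ContDiffOn ℝ ∞ P Ω)
    (hQ : ContDiffOn ℝ ∞ Q Ω) (hU : ContDiffOn ℝ ∞ U Ω) (hV : ContDiffOn ℝ ∞ V Ω)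
    (h0 : ∀ z ∈ Ω, discOf (P z) (Q z) ≠ 0) (σ : H) :
    ContDiffOn ℝ ∞ (theta σ P Q U V) Ω := by
  have h1 := contDiffOn_bezoutA hP hQ hU h0
  have h2 := contDiffOn_bezoutB hP hQ hU h0
  have h3 := contDiffOn_dirDeriv hΩ hU σ
  have h4 := contDiffOn_dirDeriv hΩ hV σ
  unfold theta
  fun_prop

theorem contDiffOn_contraction {Ω : Set H} (hΩ : IsOpen Ω) {P Q U V : H → ℂ}
    (hP : ContDiffOn ℝ ∞ P Ω) (hQ : ContDiffOn ℝ ∞ Q Ω) (hU : ContDiffOn ℝ ∞ U Ω)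
    (hV : ContDiffOn ℝ ∞ V Ω) (h0 : ∀ z ∈ Ω, discOf (P z) (Q z) ≠ 0) (τ : H) :
    ContDiffOn ℝ ∞ (contraction τ P Q U V) Ω := by
  have h1 := contDiffOn_bezoutA hP hQ hU h0
  have h2 := contDiffOn_bezoutB hP hQ hU h0
  have h3 := contDiffOn_dirDeriv hΩ hU τ
  have h4 := contDiffOn_dirDeriv hΩ hV τ
  have h5 := contDiffOn_dirDeriv hΩ hP τ
  have h6 := contDiffOn_dirDeriv hΩ hQ τ
  have h7 := contDiffOn_redM hP hQ h5 h6 hU h0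
  have h8 := contDiffOn_redN hP hQ h5 h6 hU h0
  unfold contraction
  fun_prop

/-- Two numbers agree if they agree after multiplication by `v` and by `q'(u)`: on a smooth curve
these have no common zero. -/
theorem eq_of_mul_eq {p₂ p₃ u v x y : ℂ} (h0 : discOf p₂ p₃ ≠ 0) (hc : v ^ 2 = quarticOf p₂ p₃ u)
    (h1 : v * x = v * y) (h2 : quarticDerivOf p₂ p₃ u * x = quarticDerivOf p₂ p₃ u * y) :
    x = y := by
  linear_combination (y - x) * bezout h0 u + bezoutA p₂ p₃ u * v * h1 +
    bezoutB p₂ p₃ u * h2 - (x - y) * bezoutA p₂ p₃ u * hc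

/-- The differential of the equation of the curve. -/
theorem two_mul_mul_dirDeriv {P Q U V : H → ℂ} {z w : H} (hP : DifferentiableAt ℝ P z)
    (hQ : DifferentiableAt ℝ Q z) (hU : DifferentiableAt ℝ U z) (hV : DifferentiableAt ℝ V z)
    (hd : dirDeriv w (fun z => V z ^ 2) z = dirDeriv w (fun z => quarticOf (P z) (Q z) (U z)) z) :
    2 * V z * dirDeriv w V z = quarticDerivOf (P z) (Q z) (U z) * dirDeriv w U z
      - dirDeriv w P z * U z ^ 3 - dirDeriv w Q z * U z ^ 4 := by
  unfold quarticOf at hd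
  simp (disch := fun_prop) only [dirDeriv_sub, dirDeriv_mul, dirDeriv_pow, dirDeriv_const] at hd
  rw [quarticDerivOf]
  push_cast at hd
  linear_combination hd

theorem theta_spec {P Q U V : H → ℂ} {z σ : H} (h0 : discOf (P z) (Q z) ≠ 0)
    (hc : V z ^ 2 = quarticOf (P z) (Q z) (U z))
    (hσ : 2 * V z * dirDeriv σ V z = quarticDerivOf (P z) (Q z) (U z) * dirDeriv σ U z) :
    V z * theta σ P Q U V z = dirDeriv σ U z ∧
      quarticDerivOf (P z) (Q z) (U z) * theta σ P Q U V z = 2 * dirDeriv σ V z := by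
  have hb := bezout h0 (U z)
  unfold theta
  constructor
  · linear_combination (dirDeriv σ U z) * hb + bezoutA (P z) (Q z) (U z) * dirDeriv σ U z * hc +
      bezoutB (P z) (Q z) (U z) * hσ
  · linear_combination (2 * dirDeriv σ V z) * hb - bezoutA (P z) (Q z) (U z) * V z * hσ +
      2 * bezoutA (P z) (Q z) (U z) * dirDeriv σ V z * hc

theorem contraction_spec {P Q U V : H → ℂ} {z τ : H} (h0 : discOf (P z) (Q z) ≠ 0)
    (hc : V z ^ 2 = quarticOf (P z) (Q z) (U z))
    (hτ : 2 * V z * dirDeriv τ V z = quarticDerivOf (P z) (Q z) (U z) * dirDeriv τ U z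
      - dirDeriv τ P z * U z ^ 3 - dirDeriv τ Q z * U z ^ 4) :
    V z * contraction τ P Q U V z =
        dirDeriv τ U z + redN (P z) (Q z) (dirDeriv τ P z) (dirDeriv τ Q z) (U z) ∧
      quarticDerivOf (P z) (Q z) (U z) * contraction τ P Q U V z = 2 * dirDeriv τ V z -
        redM (P z) (Q z) (dirDeriv τ P z) (dirDeriv τ Q z) (U z) * V z := by
  have hb := bezout h0 (U z)
  have hr := reduction h0 (dirDeriv τ P z) (dirDeriv τ Q z) (U z)
  unfold contraction
  set M := redM (P z) (Q z) (dirDeriv τ P z) (dirDeriv τ Q z) (U z)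
  set N := redN (P z) (Q z) (dirDeriv τ P z) (dirDeriv τ Q z) (U z)
  -- the two defining equations are compatible
  have hk : V z * (2 * dirDeriv τ V z - M * V z) =
      quarticDerivOf (P z) (Q z) (U z) * (dirDeriv τ U z + N) := by
    linear_combination hτ + hr - M * hc
  constructor
  · linear_combination (dirDeriv τ U z + N) * hb +
      bezoutA (P z) (Q z) (U z) * (dirDeriv τ U z + N) * hc + bezoutB (P z) (Q z) (U z) * hk
  · linear_combination (2 * dirDeriv τ V z - M * V z) * hb -
      bezoutA (P z) (Q z) (U z) * V z * hk +
      bezoutA (P z) (Q z) (U z) * (2 * dirDeriv τ V z - M * V z) * hc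

/-- The Gauss-Manin derivative of `du/v`: up to the derivative of `contraction` along the path, the
derivative in the direction `τ` of the parameters is multiplication by `-(M/2 + N')`. -/
theorem dirDeriv_theta {Ω : Set H} (hΩ : IsOpen Ω) {P Q U V : H → ℂ}
    (hP : ContDiffOn ℝ ∞ P Ω) (hQ : ContDiffOn ℝ ∞ Q Ω) (hU : ContDiffOn ℝ ∞ U Ω)
    (hV : ContDiffOn ℝ ∞ V Ω) (h0 : ∀ z ∈ Ω, discOf (P z) (Q z) ≠ 0)
    (hc : ∀ z ∈ Ω, V z ^ 2 = quarticOf (P z) (Q z) (U z)) (τ σ : H)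
    (hPσ : ∀ z ∈ Ω, dirDeriv σ P z = 0) (hQσ : ∀ z ∈ Ω, dirDeriv σ Q z = 0) {z : H}
    (hz : z ∈ Ω) :
    dirDeriv τ (theta σ P Q U V) z =
      -(redM (P z) (Q z) (dirDeriv τ P z) (dirDeriv τ Q z) (U z) / 2 +
        redNDeriv (P z) (Q z) (dirDeriv τ P z) (dirDeriv τ Q z) (U z)) * theta σ P Q U V z +
      dirDeriv σ (contraction τ P Q U V) z := by
  have nh : ∀ z ∈ Ω, Ω ∈ 𝓝 z := fun z hz => hΩ.mem_nhds hz
  have df : ∀ {f : H → ℂ}, ContDiffOn ℝ ∞ f Ω → ∀ z ∈ Ω, DifferentiableAt ℝ f z :=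
    fun hf z hz => (hf.contDiffAt (nh z hz)).differentiableAt (by simp)
  have hds : ∀ w, ∀ z ∈ Ω, 2 * V z * dirDeriv w V z =
      quarticDerivOf (P z) (Q z) (U z) * dirDeriv w U z
      - dirDeriv w P z * U z ^ 3 - dirDeriv w Q z * U z ^ 4 := by
    intro w z hz
    refine two_mul_mul_dirDeriv (df hP z hz) (df hQ z hz) (df hU z hz) (df hV z hz)
      (dirDeriv_congr ?_)
    filter_upwards [nh z hz] with y hy using hc y hy
  have hθ : ∀ z ∈ Ω, _ := fun z hz => theta_spec (σ := σ) (h0 z hz) (hc z hz)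
    (by rw [hds σ z hz, hPσ z hz, hQσ z hz]; ring)
  have hG : ∀ z ∈ Ω, _ := fun z hz => contraction_spec (h0 z hz) (hc z hz) (hds τ z hz)
  have cθ := df (contDiffOn_theta hΩ hP hQ hU hV h0 σ) z hz
  have cG := df (contDiffOn_contraction hΩ hP hQ hU hV h0 τ) z hz
  have dP := df hP z hz
  have dQ := df hQ z hz
  have dU := df hU z hz
  have dV := df hV z hz
  have dPτ := df (contDiffOn_dirDeriv hΩ hP τ) z hz
  have dQτ := df (contDiffOn_dirDeriv hΩ hQ τ) z hz
  have dUτ := df (contDiffOn_dirDeriv hΩ hU τ) z hz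
  have dVτ := df (contDiffOn_dirDeriv hΩ hV τ) z hz
  have dUσ := df (contDiffOn_dirDeriv hΩ hU σ) z hz
  have dVσ := df (contDiffOn_dirDeriv hΩ hV σ) z hz
  have dM := df (contDiffOn_redM hP hQ (contDiffOn_dirDeriv hΩ hP τ)
    (contDiffOn_dirDeriv hΩ hQ τ) hU h0) z hz
  have dN := df (contDiffOn_redN hP hQ (contDiffOn_dirDeriv hΩ hP τ)
    (contDiffOn_dirDeriv hΩ hQ τ) hU h0) z hz
  have hPτσ : dirDeriv σ (dirDeriv τ P) z = 0 := by
    rw [dirDeriv_comm hΩ hP σ τ hz, dirDeriv_congr (g := fun _ => 0), dirDeriv_const]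
    filter_upwards [nh z hz] with y hy using hPσ y hy
  have hQτσ : dirDeriv σ (dirDeriv τ Q) z = 0 := by
    rw [dirDeriv_comm hΩ hQ σ τ hz, dirDeriv_congr (g := fun _ => 0), dirDeriv_const]
    filter_upwards [nh z hz] with y hy using hQσ y hy
  -- the derivatives along the path of the polynomials `M` and `N`
  have ddisc : DifferentiableAt ℝ (fun z => discOf (P z) (Q z)) z := by
    unfold discOf; fun_prop
  have hdisc : dirDeriv σ (fun z => discOf (P z) (Q z)) z = 0 := by
    unfold discOf
    simp (disch := fun_prop) only [dirDeriv_sub, dirDeriv_mul, dirDeriv_pow, dirDeriv_const,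
      hPσ z hz, hQσ z hz]
    simp
  have hz0 := h0 z hz
  have hMσ : dirDeriv σ (fun z => redM (P z) (Q z) (dirDeriv τ P z) (dirDeriv τ Q z) (U z)) z =
      redMDeriv (P z) (Q z) (dirDeriv τ P z) (dirDeriv τ Q z) (U z) * dirDeriv σ U z := by
    simp only [redM, redMDeriv]
    rw [dirDeriv_div (by fun_prop) ddisc hz0, hdisc]
    simp (disch := first | fun_prop | norm_num) only [dirDeriv_sub, dirDeriv_add, dirDeriv_neg,
      dirDeriv_mul, dirDeriv_div, dirDeriv_pow, dirDeriv_const, hPσ z hz, hQσ z hz, hPτσ, hQτσ]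
    field_simp
    push_cast
    ring
  have hNσ : dirDeriv σ (fun z => redN (P z) (Q z) (dirDeriv τ P z) (dirDeriv τ Q z) (U z)) z =
      redNDeriv (P z) (Q z) (dirDeriv τ P z) (dirDeriv τ Q z) (U z) * dirDeriv σ U z := by
    simp only [redN, redNDeriv]
    rw [dirDeriv_div (by fun_prop) ddisc hz0, hdisc]
    simp (disch := first | fun_prop | norm_num) only [dirDeriv_sub, dirDeriv_add, dirDeriv_neg,
      dirDeriv_mul, dirDeriv_div, dirDeriv_pow, dirDeriv_const, hPσ z hz, hQσ z hz, hPτσ, hQτσ]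
    field_simp
    push_cast
    ring
  -- The four equations that characterise `theta` and `contraction` are differentiated in the
  -- other direction; the mixed derivatives of `U` and `V` then cancel.
  have e1 : dirDeriv τ (fun z => V z * theta σ P Q U V z) z = dirDeriv τ (dirDeriv σ U) z := by
    refine dirDeriv_congr ?_
    filter_upwards [nh z hz] with y hy using (hθ y hy).1
  have e2 : dirDeriv τ (fun z => quarticDerivOf (P z) (Q z) (U z) * theta σ P Q U V z) z =
      dirDeriv τ (fun z => 2 * dirDeriv σ V z) z := by
    refine dirDeriv_congr ?_
    filter_upwards [nh z hz] with y hy using (hθ y hy).2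
  have e3 : dirDeriv σ (fun z => V z * contraction τ P Q U V z) z = dirDeriv σ (fun z =>
      dirDeriv τ U z + redN (P z) (Q z) (dirDeriv τ P z) (dirDeriv τ Q z) (U z)) z := by
    refine dirDeriv_congr ?_
    filter_upwards [nh z hz] with y hy using (hG y hy).1
  have e4 : dirDeriv σ (fun z => quarticDerivOf (P z) (Q z) (U z) * contraction τ P Q U V z) z =
      dirDeriv σ (fun z => 2 * dirDeriv τ V z -
        redM (P z) (Q z) (dirDeriv τ P z) (dirDeriv τ Q z) (U z) * V z) z := by
    refine dirDeriv_congr ?_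
    filter_upwards [nh z hz] with y hy using (hG y hy).2
  have dq : DifferentiableAt ℝ (fun z => quarticDerivOf (P z) (Q z) (U z)) z := by
    unfold quarticDerivOf; fun_prop
  have hq : ∀ w, dirDeriv w (fun z => quarticDerivOf (P z) (Q z) (U z)) z =
      -(3 * dirDeriv w P z * U z ^ 2) - 4 * dirDeriv w Q z * U z ^ 3 -
        (6 * P z * U z + 12 * Q z * U z ^ 2) * dirDeriv w U z := by
    intro w
    unfold quarticDerivOf
    simp (disch := fun_prop) only [dirDeriv_sub, dirDeriv_mul, dirDeriv_pow, dirDeriv_const]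
    push_cast
    ring
  rw [dirDeriv_mul dV cθ] at e1
  rw [dirDeriv_mul dq cθ, dirDeriv_mul (differentiableAt_const _) dVσ, dirDeriv_const, hq] at e2
  rw [dirDeriv_mul dV cG, dirDeriv_add dUτ dN, hNσ, ← dirDeriv_comm hΩ hU τ σ hz] at e3
  rw [dirDeriv_mul dq cG, dirDeriv_sub (by fun_prop) (by fun_prop),
    dirDeriv_mul (differentiableAt_const _) dVτ, dirDeriv_const,
    dirDeriv_mul dM dV, hMσ, hq, ← dirDeriv_comm hΩ hV τ σ hz, hPσ z hz, hQσ z hz] at e4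
  obtain ⟨t1, t2⟩ := hθ z hz
  obtain ⟨c1, c2⟩ := hG z hz
  have hcz := hc z hz
  have hr := reduction_deriv hz0 (dirDeriv τ P z) (dirDeriv τ Q z) (U z)
  set M := redM (P z) (Q z) (dirDeriv τ P z) (dirDeriv τ Q z) (U z)
  set N := redN (P z) (Q z) (dirDeriv τ P z) (dirDeriv τ Q z) (U z)
  set M' := redMDeriv (P z) (Q z) (dirDeriv τ P z) (dirDeriv τ Q z) (U z)
  set N' := redNDeriv (P z) (Q z) (dirDeriv τ P z) (dirDeriv τ Q z) (U z)
  set θ := theta σ P Q U V z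
  set G := contraction τ P Q U V z
  refine eq_of_mul_eq hz0 hcz ?_ ?_
  · linear_combination e1 - e3 - G / 2 * t2 + θ / 2 * c2 + N' * t1
  · linear_combination e2 - e4 - θ * hr - M / 2 * t2 + M' * θ * hcz - M' * V z * t1 +
      (6 * P z * U z + 12 * Q z * U z ^ 2) * (G * t1 - θ * c1)

end DirDeriv

/-! ### Differentiation of the integrals over a family of paths -/

section Family

theorem continuous_slice {E : Type*} [TopologicalSpace E] {W : Set E} {Φ : E × ℝ → ℂ}
    (hΦ : ContinuousOn Φ (W ×ˢ Set.univ)) {x : E} (hx : x ∈ W) : Continuous fun s : ℝ => Φ (x, s) :=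
  continuousOn_univ.1 <| hΦ.comp (by fun_prop) fun _ _ => ⟨hx, Set.mem_univ _⟩

variable {E : Type*} [NormedAddCommGroup E] [NormedSpace ℝ E]

/-- Differentiation under the integral sign for a smooth integrand. -/
theorem exists_hasFDerivAt_integral {W : Set E} (hW : IsOpen W) {Φ : E × ℝ → ℂ}
    (hΦ : ContDiffOn ℝ ∞ Φ (W ×ˢ Set.univ)) {x : E} (hx : x ∈ W) :
    ∃ L : E →L[ℝ] ℂ, HasFDerivAt (fun x => ∫ s in (0 : ℝ)..1, Φ (x, s)) L x ∧
      ∀ τ, L τ = ∫ s in (0 : ℝ)..1, dirDeriv (τ, 0) Φ (x, s) := by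
  have hΩ : IsOpen (W ×ˢ (Set.univ : Set ℝ)) := hW.prod isOpen_univ
  have hc : ContinuousOn (fderiv ℝ Φ) (W ×ˢ Set.univ) :=
    (hΦ.fderiv_of_isOpen (m := ∞) hΩ (by simp)).continuousOn
  let F' : E → ℝ → E →L[ℝ] ℂ := fun y s => (fderiv ℝ Φ (y, s)).comp (.inl ℝ E ℝ)
  have hF' : Continuous (F' x) := by
    have : Continuous fun s : ℝ => fderiv ℝ Φ (x, s) :=
      continuousOn_univ.1 <| hc.comp (by fun_prop) fun _ _ => ⟨hx, Set.mem_univ _⟩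
    exact this.clm_comp continuous_const
  -- the derivative is bounded near the compact set `{x} × [0, 1]`
  obtain ⟨C, hC⟩ : ∃ C : ℝ, ∀ s ∈ Set.Icc (0 : ℝ) 1, ‖fderiv ℝ Φ (x, s)‖ < C := by
    have : ContinuousOn (fun s : ℝ => fderiv ℝ Φ (x, s)) (Set.Icc 0 1) :=
      hc.comp (by fun_prop) fun _ _ => ⟨hx, Set.mem_univ _⟩
    obtain ⟨C, hC⟩ := isCompact_Icc.exists_bound_of_continuousOn this
    exact ⟨C + 1, fun s hs => (hC s hs).trans_lt (by linarith)⟩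
  have ho : IsOpen ((W ×ˢ Set.univ) ∩ (fun z => ‖fderiv ℝ Φ z‖) ⁻¹' Set.Iio C) :=
    hc.norm.isOpen_inter_preimage hΩ isOpen_Iio
  obtain ⟨u, v, hu, -, hxu, hsv, huv⟩ := generalized_tube_lemma (s := {x}) isCompact_singleton
    (t := Set.Icc (0 : ℝ) 1) isCompact_Icc ho
    (by rintro ⟨y, s⟩ ⟨rfl, hs⟩; exact ⟨⟨hx, Set.mem_univ _⟩, hC s hs⟩)
  have hI : ∀ s ∈ Set.uIoc (0 : ℝ) 1, s ∈ Set.Icc (0 : ℝ) 1 := by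
    intro s hs
    rw [Set.uIoc_of_le zero_le_one] at hs
    exact ⟨hs.1.le, hs.2⟩
  have key := intervalIntegral.hasFDerivAt_integral_of_dominated_of_fderiv_le (𝕜 := ℝ)
    (μ := MeasureTheory.volume) (a := 0) (b := 1) (F := fun y s => Φ (y, s)) (F' := F') (x₀ := x)
    (s := u) (bound := fun _ => C * ‖ContinuousLinearMap.inl ℝ E ℝ‖)
    (hu.mem_nhds (hxu rfl)) ?_ ?_ hF'.aestronglyMeasurable ?_ ?_ ?_
  · refine ⟨_, key, fun τ => ?_⟩
    rw [ContinuousLinearMap.intervalIntegral_apply (hF'.intervalIntegrable _ _)]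
    simp [F', dirDeriv]
  · filter_upwards [hW.mem_nhds hx] with y hy
    exact (continuous_slice hΦ.continuousOn hy).aestronglyMeasurable
  · exact (continuous_slice hΦ.continuousOn hx).intervalIntegrable _ _
  · refine Filter.Eventually.of_forall fun s hs y hy => ?_
    refine (ContinuousLinearMap.opNorm_comp_le _ _).trans ?_
    gcongr
    exact (huv (Set.mk_mem_prod hy (hsv (hI s hs)))).2.le
  · exact intervalIntegrable_const
  · refine Filter.Eventually.of_forall fun s hs y hy => ?_
    have hz := (huv (Set.mk_mem_prod hy (hsv (hI s hs)))).1
    have hd := ((hΦ.contDiffAt (hΩ.mem_nhds hz)).differentiableAt (by simp)).hasFDerivAt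
    exact hd.comp y (hasFDerivAt_prodMk_left y s)

/-- A smooth family of paths `s ↦ (U (x, s), V (x, s))`, `s ∈ [0, 1]`, in the curves
`v² = 4u - p₂u³ - p₃u⁴`, whose coefficients depend on the parameter `x ∈ W`. -/
structure IsCurveFamily (W : Set E) (p₂ p₃ : E → ℂ) (U V : E × ℝ → ℂ) : Prop where
  isOpen : IsOpen W
  smooth₂ : ContDiffOn ℝ ∞ p₂ W
  smooth₃ : ContDiffOn ℝ ∞ p₃ W
  smoothU : ContDiffOn ℝ ∞ U (W ×ˢ Set.univ)
  smoothV : ContDiffOn ℝ ∞ V (W ×ˢ Set.univ)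
  disc_ne : ∀ x ∈ W, discOf (p₂ x) (p₃ x) ≠ 0
  curve : ∀ x ∈ W, ∀ s ∈ Set.Icc (0 : ℝ) 1,
    V (x, s) ^ 2 = quarticOf (p₂ x) (p₃ x) (U (x, s))

/-- The integrand of `∫ du/v` for a family of paths. -/
def familyTheta (p₂ p₃ : E → ℂ) (U V : E × ℝ → ℂ) : E × ℝ → ℂ :=
  theta ((0, 1) : E × ℝ) (fun z => p₂ z.1) (fun z => p₃ z.1) U V

/-- The function `(U_τ + N)/V` for a family of paths and a direction `τ` of the parameter. -/
def familyContraction (τ : E) (p₂ p₃ : E → ℂ) (U V : E × ℝ → ℂ) : E × ℝ → ℂ :=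
  contraction ((τ, 0) : E × ℝ) (fun z => p₂ z.1) (fun z => p₃ z.1) U V

variable {W : Set E} {p₂ p₃ : E → ℂ} {U V : E × ℝ → ℂ}

theorem dirDeriv_weight {H : Type*} [NormedAddCommGroup H] [NormedSpace ℝ H] {P Q U : H → ℂ}
    {w z : H} (hP : DifferentiableAt ℝ P z) (hQ : DifferentiableAt ℝ Q z)
    (hU : DifferentiableAt ℝ U z) :
    dirDeriv w (fun z => weight (P z) (Q z) (U z)) z =
      weight (dirDeriv w P z) (dirDeriv w Q z) (U z) +
        (P z / 4 + Q z * U z) * dirDeriv w U z := by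
  unfold weight
  simp (disch := first | fun_prop | norm_num) only [dirDeriv_add, dirDeriv_mul, dirDeriv_div,
    dirDeriv_pow, dirDeriv_const]
  push_cast
  ring

theorem dirDeriv_comp_fst {p : E → ℂ} {x : E} (hp : DifferentiableAt ℝ p x) (τ : E) (r s : ℝ) :
    dirDeriv ((τ, r) : E × ℝ) (fun z : E × ℝ => p z.1) (x, s) = fderiv ℝ p x τ := by
  have h : HasFDerivAt (fun z : E × ℝ => p z.1) _ (x, s) :=
    HasFDerivAt.comp (x, s) (f := Prod.fst) hp.hasFDerivAt hasFDerivAt_fst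
  rw [dirDeriv, h.fderiv]
  simp

theorem dirDeriv_left {f : E × ℝ → ℂ} {x : E} {s : ℝ} (hf : DifferentiableAt ℝ f (x, s)) (τ : E) :
    dirDeriv (τ, 0) f (x, s) = fderiv ℝ (fun y => f (y, s)) x τ := by
  have h : HasFDerivAt (fun y => f (y, s)) _ x :=
    HasFDerivAt.comp x (g := f) hf.hasFDerivAt (hasFDerivAt_prodMk_left x s)
  rw [dirDeriv, h.fderiv]
  simp

theorem hasDerivAt_right {f : E × ℝ → ℂ} {x : E} {s : ℝ} (hf : DifferentiableAt ℝ f (x, s)) :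
    HasDerivAt (fun r => f (x, r)) (dirDeriv (0, 1) f (x, s)) s := by
  have h : HasFDerivAt (fun r => f (x, r)) _ s :=
    HasFDerivAt.comp s (g := f) hf.hasFDerivAt (hasFDerivAt_prodMk_right x s)
  have := h.hasDerivAt
  simpa [dirDeriv] using this

namespace IsCurveFamily

theorem isOpen_prod (h : IsCurveFamily W p₂ p₃ U V) : IsOpen (W ×ˢ (Set.univ : Set ℝ)) :=
  h.isOpen.prod isOpen_univ

theorem smooth₂' (h : IsCurveFamily W p₂ p₃ U V) :
    ContDiffOn ℝ ∞ (fun z : E × ℝ => p₂ z.1) (W ×ˢ Set.univ) :=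
  h.smooth₂.comp contDiffOn_fst fun _ hz => hz.1

theorem smooth₃' (h : IsCurveFamily W p₂ p₃ U V) :
    ContDiffOn ℝ ∞ (fun z : E × ℝ => p₃ z.1) (W ×ˢ Set.univ) :=
  h.smooth₃.comp contDiffOn_fst fun _ hz => hz.1

theorem differentiableAt₂ (h : IsCurveFamily W p₂ p₃ U V) {x : E} (hx : x ∈ W) :
    DifferentiableAt ℝ p₂ x :=
  (h.smooth₂.contDiffAt (h.isOpen.mem_nhds hx)).differentiableAt (by simp)

theorem differentiableAt₃ (h : IsCurveFamily W p₂ p₃ U V) {x : E} (hx : x ∈ W) :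
    DifferentiableAt ℝ p₃ x :=
  (h.smooth₃.contDiffAt (h.isOpen.mem_nhds hx)).differentiableAt (by simp)

theorem differentiableAt (h : IsCurveFamily W p₂ p₃ U V) {f : E × ℝ → ℂ}
    (hf : ContDiffOn ℝ ∞ f (W ×ˢ Set.univ)) {x : E} (hx : x ∈ W) (s : ℝ) :
    DifferentiableAt ℝ f (x, s) :=
  (hf.contDiffAt (h.isOpen_prod.mem_nhds ⟨hx, Set.mem_univ _⟩)).differentiableAt (by simp)

theorem contDiffOn_theta (h : IsCurveFamily W p₂ p₃ U V) :
    ContDiffOn ℝ ∞ (familyTheta p₂ p₃ U V) (W ×ˢ Set.univ) :=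
  EllipticPair.contDiffOn_theta h.isOpen_prod h.smooth₂' h.smooth₃' h.smoothU h.smoothV
    (fun z hz => h.disc_ne z.1 hz.1) _

theorem contDiffOn_contraction (h : IsCurveFamily W p₂ p₃ U V) (τ : E) :
    ContDiffOn ℝ ∞ (familyContraction τ p₂ p₃ U V) (W ×ˢ Set.univ) :=
  EllipticPair.contDiffOn_contraction h.isOpen_prod h.smooth₂' h.smooth₃' h.smoothU h.smoothV
    (fun z hz => h.disc_ne z.1 hz.1) _

theorem contDiffOn_weight (h : IsCurveFamily W p₂ p₃ U V) :
    ContDiffOn ℝ ∞ (fun z => weight (p₂ z.1) (p₃ z.1) (U z)) (W ×ˢ Set.univ) := by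
  have := h.smoothU
  have h2 := h.smooth₂'
  have h3 := h.smooth₃'
  simp only [weight, div_eq_mul_inv]
  exact ((h2.mul this).mul contDiffOn_const).add ((h3.mul (this.pow 2)).mul contDiffOn_const)

theorem theta_spec (h : IsCurveFamily W p₂ p₃ U V) {x : E} (hx : x ∈ W) {s : ℝ}
    (hs : s ∈ Set.Ioo (0 : ℝ) 1) :
    V (x, s) * familyTheta p₂ p₃ U V (x, s) = dirDeriv (0, 1) U (x, s) ∧
      quarticDerivOf (p₂ x) (p₃ x) (U (x, s)) * familyTheta p₂ p₃ U V (x, s) =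
        2 * dirDeriv (0, 1) V (x, s) := by
  have hn : W ×ˢ Set.Ioo (0 : ℝ) 1 ∈ 𝓝 (x, s) := (h.isOpen.prod isOpen_Ioo).mem_nhds ⟨hx, hs⟩
  have d := two_mul_mul_dirDeriv (w := ((0, 1) : E × ℝ)) (h.differentiableAt h.smooth₂' hx s)
    (h.differentiableAt h.smooth₃' hx s) (h.differentiableAt h.smoothU hx s)
    (h.differentiableAt h.smoothV hx s) (dirDeriv_congr (by
      filter_upwards [hn] with y hy using h.curve y.1 hy.1 y.2 ⟨hy.2.1.le, hy.2.2.le⟩))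
  rw [dirDeriv_comp_fst (h.differentiableAt₂ hx), dirDeriv_comp_fst (h.differentiableAt₃ hx)] at d
  exact EllipticPair.theta_spec (h.disc_ne x hx) (h.curve x hx s ⟨hs.1.le, hs.2.le⟩)
    (by simpa using d)

theorem contraction_spec (h : IsCurveFamily W p₂ p₃ U V) {x : E} (hx : x ∈ W) {s : ℝ}
    (hs : s ∈ Set.Icc (0 : ℝ) 1) (τ : E) :
    V (x, s) * familyContraction τ p₂ p₃ U V (x, s) = fderiv ℝ (fun y => U (y, s)) x τ +
        redN (p₂ x) (p₃ x) (fderiv ℝ p₂ x τ) (fderiv ℝ p₃ x τ) (U (x, s)) ∧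
      quarticDerivOf (p₂ x) (p₃ x) (U (x, s)) * familyContraction τ p₂ p₃ U V (x, s) =
        2 * fderiv ℝ (fun y => V (y, s)) x τ -
        redM (p₂ x) (p₃ x) (fderiv ℝ p₂ x τ) (fderiv ℝ p₃ x τ) (U (x, s)) * V (x, s) := by
  have d2 := h.differentiableAt₂ hx
  have d3 := h.differentiableAt₃ hx
  have dU := h.differentiableAt h.smoothU hx s
  have dV := h.differentiableAt h.smoothV hx s
  have hj : DifferentiableAt ℝ (fun y : E => (y, s)) x := by fun_prop
  have dU' : DifferentiableAt ℝ (fun y => U (y, s)) x := DifferentiableAt.comp x (g := U) dU hj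
  have dV' : DifferentiableAt ℝ (fun y => V (y, s)) x := DifferentiableAt.comp x (g := V) dV hj
  have d := two_mul_mul_dirDeriv (w := τ) d2 d3 dU' dV' (dirDeriv_congr (by
      filter_upwards [h.isOpen.mem_nhds hx] with y hy using h.curve y hy s hs))
  have hsp := EllipticPair.contraction_spec (P := fun z : E × ℝ => p₂ z.1)
    (Q := fun z : E × ℝ => p₃ z.1) (U := U) (V := V) (z := (x, s)) (τ := ((τ, 0) : E × ℝ))
    (h.disc_ne x hx) (h.curve x hx s hs) (by
      rw [dirDeriv_comp_fst d2, dirDeriv_comp_fst d3, dirDeriv_left dU, dirDeriv_left dV]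
      exact d)
  rw [dirDeriv_comp_fst d2, dirDeriv_comp_fst d3, dirDeriv_left dU, dirDeriv_left dV] at hsp
  exact hsp

/-- The derivative of `∫ h du/v` follows from a pointwise formula for the derivative of its
integrand `f` up to the derivative of a function `K` along the path. -/
theorem exists_hasFDerivAt_of_pointwise (h : IsCurveFamily W p₂ p₃ U V) {f : E × ℝ → ℂ}
    (hf : ContDiffOn ℝ ∞ f (W ×ˢ Set.univ)) {K g : E → E × ℝ → ℂ}
    (hK : ∀ τ, ContDiffOn ℝ ∞ (K τ) (W ×ˢ Set.univ))
    {x : E} (hx : x ∈ W) (hg : ∀ τ, Continuous fun s => g τ (x, s))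
    (hp : ∀ τ, ∀ s ∈ Set.Ioo (0 : ℝ) 1,
      dirDeriv (τ, 0) f (x, s) = g τ (x, s) + dirDeriv (0, 1) (K τ) (x, s)) :
    ∃ L : E →L[ℝ] ℂ, HasFDerivAt (fun x => ∫ s in (0 : ℝ)..1, f (x, s)) L x ∧
      ∀ τ, L τ = (∫ s in (0 : ℝ)..1, g τ (x, s)) + (K τ (x, 1) - K τ (x, 0)) := by
  obtain ⟨L, hL, hLτ⟩ := exists_hasFDerivAt_integral h.isOpen hf hx
  refine ⟨L, hL, fun τ => ?_⟩
  have c1 : Continuous fun s => dirDeriv (τ, 0) f (x, s) :=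
    continuous_slice (contDiffOn_dirDeriv h.isOpen_prod hf _).continuousOn hx
  have c2 : Continuous fun s => K τ (x, s) := continuous_slice (hK τ).continuousOn hx
  have hF := intervalIntegral.integral_eq_sub_of_hasDerivAt_of_le zero_le_one c2.continuousOn
    (f' := fun s => dirDeriv (τ, 0) f (x, s) - g τ (x, s))
    (fun s hs => by
      rw [hp τ s hs, add_sub_cancel_left]
      exact hasDerivAt_right (h.differentiableAt (hK τ) hx s))
    ((c1.sub (hg τ)).intervalIntegrable _ _)
  rw [intervalIntegral.integral_sub (c1.intervalIntegrable _ _)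
    ((hg τ).intervalIntegrable _ _)] at hF
  rw [hLτ, ← hF]
  ring

/-- The Gauss-Manin derivative of `∫ du/v`, with boundary terms. -/
theorem hasFDerivAt_theta (h : IsCurveFamily W p₂ p₃ U V) {x : E} (hx : x ∈ W) :
    ∃ L : E →L[ℝ] ℂ,
      HasFDerivAt (fun x => ∫ s in (0 : ℝ)..1, familyTheta p₂ p₃ U V (x, s)) L x ∧
      ∀ τ, L τ = (-(discDerivOf (p₂ x) (p₃ x) (fderiv ℝ p₂ x τ) (fderiv ℝ p₃ x τ) / 12) *
            (∫ s in (0 : ℝ)..1, familyTheta p₂ p₃ U V (x, s)) -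
          3 / 2 * alphaOf (p₂ x) (p₃ x) (fderiv ℝ p₂ x τ) (fderiv ℝ p₃ x τ) *
            ∫ s in (0 : ℝ)..1, weight (p₂ x) (p₃ x) (U (x, s)) * familyTheta p₂ p₃ U V (x, s)) /
          discOf (p₂ x) (p₃ x) +
        (familyContraction τ p₂ p₃ U V (x, 1) - familyContraction τ p₂ p₃ U V (x, 0)) := by
  have cθ := continuous_slice h.contDiffOn_theta.continuousOn hx
  have cw : Continuous fun s => weight (p₂ x) (p₃ x) (U (x, s)) :=
    continuous_slice h.contDiffOn_weight.continuousOn hx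
  refine (h.exists_hasFDerivAt_of_pointwise h.contDiffOn_theta
    (K := fun τ => familyContraction τ p₂ p₃ U V)
    (g := fun τ z => (-(discDerivOf (p₂ x) (p₃ x) (fderiv ℝ p₂ x τ) (fderiv ℝ p₃ x τ) / 12) *
          familyTheta p₂ p₃ U V z -
        3 / 2 * alphaOf (p₂ x) (p₃ x) (fderiv ℝ p₂ x τ) (fderiv ℝ p₃ x τ) *
          (weight (p₂ x) (p₃ x) (U z) * familyTheta p₂ p₃ U V z)) / discOf (p₂ x) (p₃ x))
    h.contDiffOn_contraction hx (fun τ => by fun_prop) (fun τ s hs => ?_)).imp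
    fun L hL => ⟨hL.1, fun τ => ?_⟩
  rotate_left
  · rw [hL.2, intervalIntegral.integral_div, intervalIntegral.integral_sub,
      intervalIntegral.integral_const_mul, intervalIntegral.integral_const_mul]
    · exact Continuous.intervalIntegrable (by fun_prop) _ _
    · exact Continuous.intervalIntegrable (by fun_prop) _ _
  · have hm : W ×ˢ Set.Ioo (0 : ℝ) 1 ⊆ W ×ˢ Set.univ := Set.prod_mono_right (Set.subset_univ _)
    have key := dirDeriv_theta (h.isOpen.prod isOpen_Ioo) (h.smooth₂'.mono hm) (h.smooth₃'.mono hm)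
      (h.smoothU.mono hm) (h.smoothV.mono hm) (fun z hz => h.disc_ne z.1 hz.1)
      (fun z hz => h.curve z.1 hz.1 z.2 ⟨hz.2.1.le, hz.2.2.le⟩) ((τ, 0) : E × ℝ) ((0, 1) : E × ℝ)
      (fun z hz => by rw [dirDeriv_comp_fst (h.differentiableAt₂ hz.1)]; simp)
      (fun z hz => by rw [dirDeriv_comp_fst (h.differentiableAt₃ hz.1)]; simp)
      (z := (x, s)) ⟨hx, hs⟩
    rw [dirDeriv_comp_fst (h.differentiableAt₂ hx), dirDeriv_comp_fst (h.differentiableAt₃ hx),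
      reduction_one (h.disc_ne x hx)] at key
    refine key.trans ?_
    simp only [familyTheta, familyContraction]
    ring

/-- The boundary function in the Gauss-Manin derivative of `ω₃ = h du/v`. -/
def boundary (τ : E) (p₂ p₃ : E → ℂ) (U V : E × ℝ → ℂ) (x : E) (z : E × ℝ) : ℂ :=
  weight (p₂ z.1) (p₃ z.1) (U z) * familyContraction τ p₂ p₃ U V z +
    exactR (p₂ x) (p₃ x) (fderiv ℝ p₂ x τ) (fderiv ℝ p₃ x τ) (U z) * V z

/-- The Gauss-Manin derivative of `∫ ω₃`, with boundary terms. -/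
theorem hasFDerivAt_weight_mul_theta (h : IsCurveFamily W p₂ p₃ U V) {x : E} (hx : x ∈ W) :
    ∃ L : E →L[ℝ] ℂ,
      HasFDerivAt (fun x => ∫ s in (0 : ℝ)..1,
        weight (p₂ x) (p₃ x) (U (x, s)) * familyTheta p₂ p₃ U V (x, s)) L x ∧
      ∀ τ, L τ = (p₂ x / 8 * alphaOf (p₂ x) (p₃ x) (fderiv ℝ p₂ x τ) (fderiv ℝ p₃ x τ) *
            (∫ s in (0 : ℝ)..1, familyTheta p₂ p₃ U V (x, s)) +
          discDerivOf (p₂ x) (p₃ x) (fderiv ℝ p₂ x τ) (fderiv ℝ p₃ x τ) / 12 *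
            ∫ s in (0 : ℝ)..1, weight (p₂ x) (p₃ x) (U (x, s)) * familyTheta p₂ p₃ U V (x, s)) /
          discOf (p₂ x) (p₃ x) +
        (boundary τ p₂ p₃ U V x (x, 1) - boundary τ p₂ p₃ U V x (x, 0)) := by
  have cθ := continuous_slice h.contDiffOn_theta.continuousOn hx
  have cw : Continuous fun s => weight (p₂ x) (p₃ x) (U (x, s)) :=
    continuous_slice h.contDiffOn_weight.continuousOn hx
  have sU := h.smoothU
  have sV := h.smoothV
  have sG := h.contDiffOn_contraction
  have sw := h.contDiffOn_weight
  have sr : ∀ τ, ContDiffOn ℝ ∞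
      (fun z => exactR (p₂ x) (p₃ x) (fderiv ℝ p₂ x τ) (fderiv ℝ p₃ x τ) (U z))
      (W ×ˢ Set.univ) := by
    intro τ
    simp only [exactR, div_eq_mul_inv]
    fun_prop
  refine (h.exists_hasFDerivAt_of_pointwise
    (f := fun z => weight (p₂ z.1) (p₃ z.1) (U z) * familyTheta p₂ p₃ U V z)
    (sw.mul h.contDiffOn_theta)
    (K := fun τ => boundary τ p₂ p₃ U V x)
    (g := fun τ z => (p₂ x / 8 * alphaOf (p₂ x) (p₃ x) (fderiv ℝ p₂ x τ) (fderiv ℝ p₃ x τ) *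
          familyTheta p₂ p₃ U V z +
        discDerivOf (p₂ x) (p₃ x) (fderiv ℝ p₂ x τ) (fderiv ℝ p₃ x τ) / 12 *
          (weight (p₂ x) (p₃ x) (U z) * familyTheta p₂ p₃ U V z)) / discOf (p₂ x) (p₃ x))
    (fun τ => (sw.mul (sG τ)).add ((sr τ).mul sV)) hx (fun τ => by fun_prop) (fun τ s hs => ?_)).imp
    fun L hL => ⟨hL.1, fun τ => ?_⟩
  rotate_left
  · rw [hL.2, intervalIntegral.integral_div, intervalIntegral.integral_add,
      intervalIntegral.integral_const_mul, intervalIntegral.integral_const_mul]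
    · exact Continuous.intervalIntegrable (by fun_prop) _ _
    · exact Continuous.intervalIntegrable (by fun_prop) _ _
  · have hm : W ×ˢ Set.Ioo (0 : ℝ) 1 ⊆ W ×ˢ Set.univ := Set.prod_mono_right (Set.subset_univ _)
    have key := dirDeriv_theta (h.isOpen.prod isOpen_Ioo) (h.smooth₂'.mono hm) (h.smooth₃'.mono hm)
      (h.smoothU.mono hm) (h.smoothV.mono hm) (fun z hz => h.disc_ne z.1 hz.1)
      (fun z hz => h.curve z.1 hz.1 z.2 ⟨hz.2.1.le, hz.2.2.le⟩) ((τ, 0) : E × ℝ) ((0, 1) : E × ℝ)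
      (fun z hz => by rw [dirDeriv_comp_fst (h.differentiableAt₂ hz.1)]; simp)
      (fun z hz => by rw [dirDeriv_comp_fst (h.differentiableAt₃ hz.1)]; simp)
      (z := (x, s)) ⟨hx, hs⟩
    change dirDeriv (τ, 0) (familyTheta p₂ p₃ U V) (x, s) =
      _ * familyTheta p₂ p₃ U V (x, s) +
        dirDeriv (0, 1) (familyContraction τ p₂ p₃ U V) (x, s) at key
    have d2 := h.differentiableAt h.smooth₂' hx s
    have d3 := h.differentiableAt h.smooth₃' hx s
    have dU := h.differentiableAt sU hx s
    have dV := h.differentiableAt sV hx s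
    have dθ := h.differentiableAt h.contDiffOn_theta hx s
    have dG := h.differentiableAt (sG τ) hx s
    have dw := h.differentiableAt sw hx s
    have dr := h.differentiableAt (sr τ) hx s
    have hwd : ∀ w : E × ℝ, dirDeriv w (fun z => weight (p₂ z.1) (p₃ z.1) (U z)) (x, s) =
        weight (fderiv ℝ p₂ x w.1) (fderiv ℝ p₃ x w.1) (U (x, s)) +
          (p₂ x / 4 + p₃ x * U (x, s)) * dirDeriv w U (x, s) := by
      intro w
      rw [dirDeriv_weight d2 d3 dU, dirDeriv_comp_fst (h.differentiableAt₂ hx),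
        dirDeriv_comp_fst (h.differentiableAt₃ hx)]
    have hrd : dirDeriv ((0, 1) : E × ℝ) (fun z =>
        exactR (p₂ x) (p₃ x) (fderiv ℝ p₂ x τ) (fderiv ℝ p₃ x τ) (U z)) (x, s) =
        alphaOf (p₂ x) (p₃ x) (fderiv ℝ p₂ x τ) (fderiv ℝ p₃ x τ) * (3 * p₃ x / 8) /
          discOf (p₂ x) (p₃ x) * dirDeriv (0, 1) U (x, s) := by
      simp only [exactR, div_eq_mul_inv]
      simp (disch := fun_prop) only [dirDeriv_add, dirDeriv_mul, dirDeriv_const]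
      ring
    obtain ⟨t1, t2⟩ := h.theta_spec hx hs
    obtain ⟨c1, -⟩ := h.contraction_spec hx ⟨hs.1.le, hs.2.le⟩ τ
    rw [← dirDeriv_left dU τ] at c1
    have hcz := h.curve x hx s ⟨hs.1.le, hs.2.le⟩
    have hr := reduction_weight (h.disc_ne x hx) (fderiv ℝ p₂ x τ) (fderiv ℝ p₃ x τ) (U (x, s))
    unfold boundary
    rw [dirDeriv_mul dw dθ, dirDeriv_add (dw.fun_mul dG) (dr.fun_mul dV), dirDeriv_mul dw dG,
      dirDeriv_mul dr dV, hwd, hwd, hrd, key]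
    rw [dirDeriv_comp_fst (h.differentiableAt₂ hx), dirDeriv_comp_fst (h.differentiableAt₃ hx)]
    have w0 : weight (fderiv ℝ p₂ x 0) (fderiv ℝ p₃ x 0) (U (x, s)) = 0 := by simp [weight]
    simp only [w0]
    set θ := familyTheta p₂ p₃ U V (x, s)
    set G := familyContraction τ p₂ p₃ U V (x, s)
    set r := exactR (p₂ x) (p₃ x) (fderiv ℝ p₂ x τ) (fderiv ℝ p₃ x τ) (U (x, s))
    set r' := alphaOf (p₂ x) (p₃ x) (fderiv ℝ p₂ x τ) (fderiv ℝ p₃ x τ) * (3 * p₃ x / 8) /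
          discOf (p₂ x) (p₃ x)
    linear_combination θ * hr - (p₂ x / 4 + p₃ x * U (x, s)) * θ * c1 +
      ((p₂ x / 4 + p₃ x * U (x, s)) * G + V (x, s) * r') * t1 + r / 2 * t2 - r' * θ * hcz

end IsCurveFamily

end Family

/-! ### The explicit matrix and the boundary terms at the marked points -/

theorem integral_congr_Ioo {f g : ℝ → ℂ} (h : ∀ s ∈ Set.Ioo (0 : ℝ) 1, f s = g s) :
    ∫ s in (0 : ℝ)..1, f s = ∫ s in (0 : ℝ)..1, g s := by
  rw [intervalIntegral.integral_of_le zero_le_one, intervalIntegral.integral_of_le zero_le_one,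
    MeasureTheory.integral_Ioc_eq_integral_Ioo, MeasureTheory.integral_Ioc_eq_integral_Ioo]
  exact MeasureTheory.setIntegral_congr_fun measurableSet_Ioo h

theorem dirDeriv_coord (i : Fin 5) (τ t : Param) : dirDeriv τ (fun t : Param => t i) t = τ i := by
  have h : HasFDerivAt (fun t : Param => t i) (ContinuousLinearMap.proj (R := ℝ) i) t :=
    hasFDerivAt_apply i t
  rw [dirDeriv, h.fderiv]
  simp

theorem dt₃_eq (t : Param) : dt₃ t = (12 * a t ^ 2 - t₂ t) • da - a t • dt₂ -
    (2 * b t) • ContinuousLinearMap.proj 1 := by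
  have h : ∀ i : Fin 5, HasFDerivAt (fun t : Param => t i) (ContinuousLinearMap.proj (R := ℂ) i) t :=
    fun i => hasFDerivAt_apply i t
  have h3 : HasFDerivAt (fun t : Param => 4 * t 0 ^ 3 - t 4 * t 0 - t 1 ^ 2) _ t :=
    ((((h 0).pow 3).const_mul 4).sub ((h 4).mul (h 0))).sub ((h 1).pow 2)
  have e : dt₃ t = _ := h3.fderiv
  rw [e]
  ext τ
  simp [da, dt₂, a, b, t₂]
  ring

theorem hasFDerivAt_t₃ (t : Param) : HasFDerivAt t₃ (dt₃ t) t := by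
  have : DifferentiableAt ℂ t₃ t := by
    unfold t₃ a b t₂; fun_prop
  exact this.hasFDerivAt

theorem dDisc_eq (t : Param) :
    dDisc t = (54 * t₃ t) • dt₃ t - (3 * t₂ t ^ 2) • dt₂ := by
  have h2 : HasFDerivAt t₂ dt₂ t := hasFDerivAt_apply 4 t
  have h : HasFDerivAt (fun t => 27 * t₃ t ^ 2 - t₂ t ^ 3) _ t :=
    (((hasFDerivAt_t₃ t).pow 2).const_mul 27).sub (h2.pow 3)
  have e : dDisc t = _ := h.fderiv
  rw [e]
  ext τ
  simp
  ring

theorem fderiv_t₂ (t τ : Param) : fderiv ℝ t₂ t τ = τ 4 := dirDeriv_coord 4 τ t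

theorem fderiv_t₃ (t τ : Param) : fderiv ℝ t₃ t τ = dt₃ t τ := by
  rw [((hasFDerivAt_t₃ t).restrictScalars ℝ).fderiv]
  rfl

theorem dt₃_apply (t τ : Param) :
    dt₃ t τ = (12 * a t ^ 2 - t₂ t) * τ 0 - a t * τ 4 - 2 * b t * τ 1 := by
  simp [dt₃_eq, da, dt₂]

theorem dDisc_apply (t τ : Param) : dDisc t τ = discDerivOf (t₂ t) (t₃ t) (τ 4) (dt₃ t τ) := by
  simp [dDisc_eq, discDerivOf, dt₂]

theorem α_apply (t τ : Param) : α t τ = alphaOf (t₂ t) (t₃ t) (τ 4) (dt₃ t τ) := by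
  simp [α, alphaOf, dt₂]

theorem isOpen_base : IsOpen Base := by
  have h0 : Continuous a := by unfold a; fun_prop
  have h1 : Continuous b := by unfold b; fun_prop
  have h2 : Continuous disc := by unfold disc t₃ a b t₂; fun_prop
  exact (isOpen_ne_fun h0 continuous_const).inter
    ((isOpen_ne_fun h1 continuous_const).inter (isOpen_ne_fun h2 continuous_const))

theorem differentiableOn_explicitMatrix (i j : Fin 3) :
    DifferentiableOn ℂ (fun t => explicitMatrix t i j) Base := by
  intro t ht
  have ha : t 0 ≠ 0 := ht.1
  have hb : t 1 ≠ 0 := ht.2.1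
  have hD : disc t ≠ 0 := ht.2.2
  have dD : DifferentiableAt ℂ disc t := by unfold disc t₃ a b t₂; fun_prop
  have d3 : DifferentiableAt ℂ t₃ t := (hasFDerivAt_t₃ t).differentiableAt
  have ddt₃ : DifferentiableAt ℂ dt₃ t := by
    have : dt₃ = _ := funext dt₃_eq
    rw [this]
    unfold a b t₂
    fun_prop
  have ddD : DifferentiableAt ℂ dDisc t := by
    have : dDisc = _ := funext dDisc_eq
    rw [this]
    unfold t₂
    fun_prop
  have dα : DifferentiableAt ℂ α t := by
    unfold α t₂
    fun_prop
  have dg₁ : DifferentiableAt ℂ g₁ t := by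
    unfold g₁ a b t₂
    fun_prop (disch := simp [ha, hb])
  have dg₂ : DifferentiableAt ℂ g₂ t := by
    unfold g₂ a b t₂
    fun_prop (disch := simp [ha, hb])
  have dg₃ : DifferentiableAt ℂ g₃ t := by
    unfold g₃ a b t₂
    fun_prop (disch := simp [ha, hb])
  have dm : DifferentiableAt ℂ (fun t => c t - b t / (2 * a t)) t := by
    unfold a b c
    fun_prop (disch := simp [ha])
  have dbD : DifferentiableAt ℂ (fun t => disc t / b t) t := by
    unfold b
    fun_prop (disch := simp [hb])
  have daD : DifferentiableAt ℂ (fun t => (a t + t₁ t) * disc t / b t) t := by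
    unfold a b t₁
    fun_prop (disch := simp [hb])
  have d1 : DifferentiableAt ℂ t₁ t := by unfold t₁; fun_prop
  have d2 : DifferentiableAt ℂ t₂ t := by unfold t₂; fun_prop
  have hi : DifferentiableAt ℂ (fun t => (disc t)⁻¹) t := dD.inv hD
  refine DifferentiableAt.differentiableWithinAt ?_
  fin_cases i <;> fin_cases j <;>
    simp only [explicitMatrix, A₂₁, A₂₂, A₂₃, A₃₁, A₃₂, A₃₃, Matrix.smul_apply, Matrix.of_apply,
      Matrix.cons_val', Matrix.cons_val_zero, Matrix.cons_val_one, Matrix.cons_val, Fin.zero_eta,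
      Fin.mk_one, Fin.reduceFinMk] <;>
    refine DifferentiableAt.smul hi ?_ <;> fun_prop

theorem contraction_eq_zero {p₂ p₃ G M : ℂ} (h : quarticDerivOf p₂ p₃ 0 * G = 2 * 0 - M * 0) :
    G = 0 := by
  simpa [quarticDerivOf] using h

/-- The coefficient `a (A₂₁ + A₂₃ (c - b/(2a)))/Δ`, which turns the boundary term of `∫ du/v` into
a multiple of the boundary values of `u`. -/
def boundaryCoeff (t τ : Param) : ℂ :=
  a t * (A₂₁ t τ + 3 / 2 * (c t - b t / (2 * a t)) * α t τ) / disc t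

/-- The analogous coefficient for the boundary term of `∫ ω₃`. -/
def boundaryCoeff' (t τ : Param) : ℂ :=
  t₁ t * boundaryCoeff t τ - a t * ((A₃₁ t τ + (c t - b t / (2 * a t)) * A₃₃ t τ) / disc t -
    (τ 2 - (τ 1 / (2 * a t) - b t * τ 0 / (2 * a t ^ 2))))

theorem contraction_at_P {t : Param} (ht : t ∈ Base) (τ : Param) {G : ℂ}
    (h : b t / a t ^ 2 * G = -τ 0 / a t ^ 2 + redN (t₂ t) (t₃ t) (τ 4) (dt₃ t τ) (1 / a t)) :
    G = boundaryCoeff t τ * (1 / a t) := by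
  have ha : a t ≠ 0 := ht.1
  have hb : b t ≠ 0 := ht.2.1
  have hD : disc t ≠ 0 := ht.2.2
  have hG : G = a t ^ 2 / b t *
      (-τ 0 / a t ^ 2 + redN (t₂ t) (t₃ t) (τ 4) (dt₃ t τ) (1 / a t)) := by
    rw [← h]; field_simp
  rw [hG, boundaryCoeff]
  simp only [A₂₁, redN, show discOf (t₂ t) (t₃ t) = disc t from rfl, g₁, g₂, da, dt₂,
    sub_apply, add_apply, smul_apply,
    ContinuousLinearMap.proj_apply, smul_eq_mul]
  field_simp
  ring

theorem boundary_at_P {t : Param} (ht : t ∈ Base) (τ : Param) {G : ℂ}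
    (h : b t / a t ^ 2 * G = -τ 0 / a t ^ 2 + redN (t₂ t) (t₃ t) (τ 4) (dt₃ t τ) (1 / a t)) :
    weight (t₂ t) (t₃ t) (1 / a t) * G +
      exactR (t₂ t) (t₃ t) (τ 4) (dt₃ t τ) (1 / a t) * (b t / a t ^ 2) =
      boundaryCoeff' t τ * (1 / a t) := by
  have ha : a t ≠ 0 := ht.1
  have hb : b t ≠ 0 := ht.2.1
  have hD : disc t ≠ 0 := ht.2.2
  have hG := contraction_at_P ht τ h
  have h1 : τ 1 = ((12 * a t ^ 2 - t₂ t) * τ 0 - a t * τ 4 - dt₃ t τ) / (2 * b t) := by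
    rw [dt₃_apply]; field_simp; ring
  rw [boundaryCoeff', ← sub_eq_zero]
  rw [hG, boundaryCoeff, h1]
  simp only [A₂₁, A₃₁, A₃₃, α_apply, dDisc_apply, exactR, weight, alphaOf, discDerivOf,
    show discOf (t₂ t) (t₃ t) = disc t from rfl, g₁, g₂, g₃, da, dt₂, dc,
    sub_apply, add_apply, smul_apply,
    ContinuousLinearMap.proj_apply, smul_eq_mul]
  field_simp
  simp only [disc, t₃]
  ring

/-! ### The explicit matrix is a Gauss-Manin matrix -/

section CycleFamily

variable {W : Set Param} {γ : Param → ℝ → ℂ × ℂ}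

theorem IsCycleFamily.isCurveFamily (hW : IsOpen W) (hWB : W ⊆ Base) (h : IsCycleFamily W γ) :
    IsCurveFamily W t₂ t₃ (fun z => (γ z.1 z.2).1) (fun z => (γ z.1 z.2).2) where
  isOpen := hW
  smooth₂ := by unfold t₂; fun_prop
  smooth₃ := by unfold t₃ a b t₂; fun_prop
  smoothU := h.1.fst
  smoothV := h.1.snd
  disc_ne := fun _ hx => (hWB hx).2.2
  curve := fun x hx s hs => h.2.1 x hx s hs

/-- On tangent vectors of the curve, `duOverV` is characterised by the two equations
`v θ = du` and `q'(u) θ = 2 dv`. -/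
theorem duOverV_eq {t : Param} (ht : t ∈ Base) {p w : ℂ × ℂ} {θ : ℂ} (hp : p ∈ Curve t)
    (h1 : p.2 * θ = w.1) (h2 : quarticDeriv t p.1 * θ = 2 * w.2) : duOverV t p w = θ := by
  unfold duOverV
  split_ifs with hv
  · have hq : quarticDeriv t p.1 ≠ 0 := by
      intro h0
      have hb := bezout (p₂ := t₂ t) (p₃ := t₃ t) ht.2.2 p.1
      have hp' : p.2 ^ 2 = quarticOf (t₂ t) (t₃ t) p.1 := hp
      have h0' : quarticDerivOf (t₂ t) (t₃ t) p.1 = 0 := h0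
      rw [← hp', h0', hv] at hb
      simp at hb
    rw [← h2]
    field_simp
  · rw [← h1]
    field_simp

theorem IsCurveFamily.deriv_path {U V : Param × ℝ → ℂ} (h : IsCurveFamily W t₂ t₃ U V) {t : Param}
    (ht : t ∈ W) (s : ℝ) : deriv (fun s => (U (t, s), V (t, s))) s =
      (dirDeriv (0, 1) U (t, s), dirDeriv (0, 1) V (t, s)) :=
  ((hasDerivAt_right (h.differentiableAt h.smoothU ht s)).prodMk
    (hasDerivAt_right (h.differentiableAt h.smoothV ht s))).deriv

/-- The periods in terms of the integrals of `du`, `du/v` and `h du/v`. -/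
theorem period_eq (hW : IsOpen W) (hWB : W ⊆ Base) (h : IsCycleFamily W γ) {t : Param}
    (ht : t ∈ W) :
    period 0 γ t = -(a t) * ((γ t 1).1 - (γ t 0).1) ∧
    period 1 γ t = -∫ s in (0 : ℝ)..1, familyTheta t₂ t₃ (fun z => (γ z.1 z.2).1)
      (fun z => (γ z.1 z.2).2) (t, s) ∧
    period 2 γ t = (c t - b t / (2 * a t)) * (-(a t) * ((γ t 1).1 - (γ t 0).1)) -
      t₁ t * (∫ s in (0 : ℝ)..1, familyTheta t₂ t₃ (fun z => (γ z.1 z.2).1)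
        (fun z => (γ z.1 z.2).2) (t, s)) +
      ∫ s in (0 : ℝ)..1, weight (t₂ t) (t₃ t) (γ t s).1 * familyTheta t₂ t₃
        (fun z => (γ z.1 z.2).1) (fun z => (γ z.1 z.2).2) (t, s) := by
  have hf := h.isCurveFamily hW hWB
  set U : Param × ℝ → ℂ := fun z => (γ z.1 z.2).1
  set V : Param × ℝ → ℂ := fun z => (γ z.1 z.2).2
  have hγ : ∀ s, deriv (γ t) s = (dirDeriv (0, 1) U (t, s), dirDeriv (0, 1) V (t, s)) :=
    hf.deriv_path ht
  have hθ : ∀ s ∈ Set.Ioo (0 : ℝ) 1, duOverV t (γ t s) (deriv (γ t) s) =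
      familyTheta t₂ t₃ U V (t, s) := by
    intro s hs
    obtain ⟨e1, e2⟩ := hf.theta_spec ht hs
    refine duOverV_eq (hWB ht) (h.2.1 t ht s ⟨hs.1.le, hs.2.le⟩) ?_ ?_
    · rw [hγ]; exact e1
    · rw [hγ]; exact e2
  have cU' : Continuous fun s => dirDeriv (0, 1) U (t, s) :=
    continuous_slice (contDiffOn_dirDeriv hf.isOpen_prod hf.smoothU _).continuousOn ht
  have cθ := continuous_slice hf.contDiffOn_theta.continuousOn ht
  have cw : Continuous fun s => weight (t₂ t) (t₃ t) (U (t, s)) :=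
    continuous_slice hf.contDiffOn_weight.continuousOn ht
  have hU : ∫ s in (0 : ℝ)..1, dirDeriv (0, 1) U (t, s) = (γ t 1).1 - (γ t 0).1 :=
    intervalIntegral.integral_eq_sub_of_hasDerivAt
      (fun s _ => hasDerivAt_right (hf.differentiableAt hf.smoothU ht s))
      (cU'.intervalIntegrable _ _)
  refine ⟨?_, ?_, ?_⟩
  · rw [← hU, ← intervalIntegral.integral_const_mul]
    refine integral_congr_Ioo fun s _ => ?_
    simp [frame, ω₁, hγ]
  · rw [← intervalIntegral.integral_neg]
    refine integral_congr_Ioo fun s hs => ?_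
    simp [frame, ω₂, hθ s hs]
  · have e : period 2 γ t = ∫ s in (0 : ℝ)..1,
        ((c t - b t / (2 * a t)) * (-(a t) * dirDeriv (0, 1) U (t, s)) -
        t₁ t * familyTheta t₂ t₃ U V (t, s) +
        weight (t₂ t) (t₃ t) (U (t, s)) * familyTheta t₂ t₃ U V (t, s)) := by
      refine integral_congr_Ioo fun s hs => ?_
      simp only [frame, ω₁, ω₂, ω₃, hθ s hs, weight, Matrix.cons_val]
      rw [hγ]
      ring
    rw [e, intervalIntegral.integral_add, intervalIntegral.integral_sub,
      intervalIntegral.integral_const_mul, intervalIntegral.integral_const_mul,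
      intervalIntegral.integral_const_mul, hU]
    all_goals exact Continuous.intervalIntegrable (by fun_prop) _ _

/-- At an end point in `{O, P}` of the paths of a family, the boundary terms are multiples of the
value of `u`. -/
theorem boundary_of_marked (hW : IsOpen W) (hWB : W ⊆ Base) (h : IsCycleFamily W γ) {s : ℝ}
    (hs : s ∈ Set.Icc (0 : ℝ) 1) (he : (∀ t ∈ W, γ t s = ptO) ∨ (∀ t ∈ W, γ t s = ptP t))
    {t : Param} (ht : t ∈ W) (τ : Param) :
    familyContraction τ t₂ t₃ (fun z => (γ z.1 z.2).1) (fun z => (γ z.1 z.2).2) (t, s) =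
      boundaryCoeff t τ * (γ t s).1 ∧
    IsCurveFamily.boundary τ t₂ t₃ (fun z => (γ z.1 z.2).1) (fun z => (γ z.1 z.2).2) t (t, s) =
      boundaryCoeff' t τ * (γ t s).1 := by
  obtain ⟨c1, c2⟩ := (h.isCurveFamily hW hWB).contraction_spec ht hs τ
  rw [fderiv_t₂, fderiv_t₃] at c1 c2
  simp only [IsCurveFamily.boundary, fderiv_t₂, fderiv_t₃]
  set G := familyContraction τ t₂ t₃ (fun z => (γ z.1 z.2).1) (fun z => (γ z.1 z.2).2) (t, s)
  simp only at c1 c2 ⊢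
  rcases he with he | he
  · have hV : fderiv ℝ (fun y => (γ y s).2) t τ = 0 := by
      have : (fun y => (γ y s).2) =ᶠ[𝓝 t] fun _ => 0 := by
        filter_upwards [hW.mem_nhds ht] with y hy
        rw [he y hy, ptO]
      rw [this.fderiv_eq]
      simp
    rw [he t ht, hV] at c2
    have hG : G = 0 := contraction_eq_zero c2
    rw [he t ht]
    simp [ptO, hG]
  · have ha : a t ≠ 0 := (hWB ht).1
    have hU : fderiv ℝ (fun y => (γ y s).1) t τ = -τ 0 / a t ^ 2 := by
      have : (fun y => (γ y s).1) =ᶠ[𝓝 t] fun y => 1 / y 0 := by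
        filter_upwards [hW.mem_nhds ht] with y hy
        rw [he y hy, ptP, a]
      rw [this.fderiv_eq]
      change dirDeriv τ (fun y : Param => 1 / y 0) t = _
      rw [dirDeriv_div (f := fun _ : Param => 1) (g := fun y : Param => y 0) (by fun_prop)
        (by fun_prop) ha, dirDeriv_const, dirDeriv_coord, a]
      ring
    rw [he t ht, hU] at c1
    rw [he t ht]
    exact ⟨contraction_at_P (hWB ht) τ c1, boundary_at_P (hWB ht) τ c1⟩

/-- The boundary terms of a family of relative cycles. -/
theorem boundary_sub_boundary (hW : IsOpen W) (hWB : W ⊆ Base) (h : IsCycleFamily W γ)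
    {t : Param} (ht : t ∈ W) (τ : Param) :
    familyContraction τ t₂ t₃ (fun z => (γ z.1 z.2).1) (fun z => (γ z.1 z.2).2) (t, 1) -
      familyContraction τ t₂ t₃ (fun z => (γ z.1 z.2).1) (fun z => (γ z.1 z.2).2) (t, 0) =
      boundaryCoeff t τ * ((γ t 1).1 - (γ t 0).1) ∧
    IsCurveFamily.boundary τ t₂ t₃ (fun z => (γ z.1 z.2).1) (fun z => (γ z.1 z.2).2) t (t, 1) -
      IsCurveFamily.boundary τ t₂ t₃ (fun z => (γ z.1 z.2).1) (fun z => (γ z.1 z.2).2) t (t, 0) =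
      boundaryCoeff' t τ * ((γ t 1).1 - (γ t 0).1) := by
  rcases h.2.2 with hc | ⟨h0, h1⟩
  · have hf := h.isCurveFamily hW hWB
    have i0 : (0 : ℝ) ∈ Set.Icc (0 : ℝ) 1 := by simp
    have i1 : (1 : ℝ) ∈ Set.Icc (0 : ℝ) 1 := by simp
    obtain ⟨c1, c2⟩ := hf.contraction_spec ht i0 τ
    obtain ⟨d1, d2⟩ := hf.contraction_spec ht i1 τ
    have hU : (fun y => (γ y 1).1) =ᶠ[𝓝 t] fun y => (γ y 0).1 := by
      filter_upwards [hW.mem_nhds ht] with y hy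
      rw [hc y hy]
    have hV : (fun y => (γ y 1).2) =ᶠ[𝓝 t] fun y => (γ y 0).2 := by
      filter_upwards [hW.mem_nhds ht] with y hy
      rw [hc y hy]
    rw [hU.fderiv_eq] at d1
    rw [hV.fderiv_eq] at d2
    simp only [← hc t ht] at c1 c2 d1 d2
    have hG := eq_of_mul_eq (hWB ht).2.2 (hf.curve t ht 0 i0) (d1.trans c1.symm) (d2.trans c2.symm)
    simp [IsCurveFamily.boundary, hG, hc t ht]
  · obtain ⟨e1, e2⟩ := boundary_of_marked hW hWB h (by simp) h0 ht τ
    obtain ⟨f1, f2⟩ := boundary_of_marked hW hWB h (by simp) h1 ht τ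
    rw [e1, e2, f1, f2]
    constructor <;> ring

theorem hasFDerivAt_of_dirDeriv {f : Param → ℂ} {t : Param} {L : Param →L[ℂ] ℂ}
    (hf : DifferentiableAt ℝ f t) (h : ∀ τ, dirDeriv τ f t = L τ) : HasFDerivAt f L t :=
  hasFDerivAt_of_restrictScalars ℝ hf.hasFDerivAt (ContinuousLinearMap.ext fun τ => (h τ).symm)

/-- The integral of `d((x - a)/x)` over a relative cycle is locally constant. -/
theorem hasFDerivAt_period_zero (hW : IsOpen W) (hWB : W ⊆ Base) (h : IsCycleFamily W γ) {t : Param}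
    (ht : t ∈ W) : HasFDerivAt (fun t => -(a t) * ((γ t 1).1 - (γ t 0).1))
      (0 : Param →L[ℝ] ℂ) t := by
  have he : ∀ s, ((∀ t ∈ W, γ t s = ptO) ∨ (∀ t ∈ W, γ t s = ptP t)) →
      ∃ k : ℂ, ∀ t ∈ W, a t * (γ t s).1 = k := by
    rintro s (h | h)
    · exact ⟨0, fun t ht => by simp [h t ht, ptO]⟩
    · exact ⟨1, fun t ht => by
        rw [h t ht, ptP]
        exact mul_one_div_cancel (hWB ht).1⟩
  obtain ⟨k, hk⟩ : ∃ k : ℂ, ∀ t ∈ W, -(a t) * ((γ t 1).1 - (γ t 0).1) = k := by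
    rcases h.2.2 with hc | ⟨h0, h1⟩
    · exact ⟨0, fun t ht => by simp [hc t ht]⟩
    · obtain ⟨k0, hk0⟩ := he 0 h0
      obtain ⟨k1, hk1⟩ := he 1 h1
      exact ⟨k0 - k1, fun t ht => by linear_combination hk0 t ht - hk1 t ht⟩
  refine (hasFDerivAt_const k t).congr_of_eventuallyEq ?_
  filter_upwards [hW.mem_nhds ht] with y hy using hk y hy

theorem explicitMatrix_apply (t τ : Param) :
    (∀ j, explicitMatrix t 0 j τ = 0) ∧
    explicitMatrix t 1 0 τ = A₂₁ t τ / disc t ∧ explicitMatrix t 1 1 τ = A₂₂ t τ / disc t ∧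
    explicitMatrix t 1 2 τ = A₂₃ t τ / disc t ∧ explicitMatrix t 2 0 τ = A₃₁ t τ / disc t ∧
    explicitMatrix t 2 1 τ = A₃₂ t τ / disc t ∧ explicitMatrix t 2 2 τ = A₃₃ t τ / disc t := by
  refine ⟨fun j => by fin_cases j <;> simp [explicitMatrix], ?_⟩
  simp [explicitMatrix, div_eq_inv_mul]

theorem isGaussManinMatrix_explicitMatrix : IsGaussManinMatrix explicitMatrix := by
  refine ⟨differentiableOn_explicitMatrix, fun W hW hWB γ h t ht i => ?_⟩
  have hn := hW.mem_nhds ht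
  have hf := h.isCurveFamily hW hWB
  have ha : a t ≠ 0 := (hWB ht).1
  have ha' : t 0 ≠ 0 := ha
  have hD : disc t ≠ 0 := (hWB ht).2.2
  set I0 : Param → ℂ := fun t => ∫ s in (0 : ℝ)..1, familyTheta t₂ t₃ (fun z => (γ z.1 z.2).1)
      (fun z => (γ z.1 z.2).2) (t, s)
  set I1 : Param → ℂ := fun t => ∫ s in (0 : ℝ)..1, weight (t₂ t) (t₃ t) (γ t s).1 *
      familyTheta t₂ t₃ (fun z => (γ z.1 z.2).1) (fun z => (γ z.1 z.2).2) (t, s)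
  set u : Param → ℂ := fun t => -(a t) * ((γ t 1).1 - (γ t 0).1)
  have hp0 : period 0 γ =ᶠ[𝓝 t] u := by
    filter_upwards [hn] with y hy using (period_eq hW hWB h hy).1
  have hp1 : period 1 γ =ᶠ[𝓝 t] fun t => -I0 t := by
    filter_upwards [hn] with y hy using (period_eq hW hWB h hy).2.1
  have hp2 : period 2 γ =ᶠ[𝓝 t]
      fun t => (c t - b t / (2 * a t)) * u t - t₁ t * I0 t + I1 t := by
    filter_upwards [hn] with y hy using (period_eq hW hWB h hy).2.2
  have D0 := hasFDerivAt_period_zero hW hWB h ht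
  obtain ⟨L0, hL0, hL0τ⟩ := hf.hasFDerivAt_theta ht
  obtain ⟨L1, hL1, hL1τ⟩ := hf.hasFDerivAt_weight_mul_theta ht
  have hb := boundary_sub_boundary hW hWB h ht
  change HasFDerivAt I0 L0 t at hL0
  change HasFDerivAt I1 L1 t at hL1
  change HasFDerivAt u 0 t at D0
  change ∀ τ, L0 τ = (_ * I0 t - _ * I1 t) / _ + _ at hL0τ
  change ∀ τ, L1 τ = (_ * I0 t + _ * I1 t) / _ + _ at hL1τ
  have hDD : discOf (t₂ t) (t₃ t) = disc t := rfl
  simp only [fderiv_t₂, fderiv_t₃, (hb _).1, hDD, ← α_apply, ← dDisc_apply] at hL0τ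
  simp only [fderiv_t₂, fderiv_t₃, (hb _).2, hDD, ← α_apply, ← dDisc_apply] at hL1τ
  have hu : u t = -(a t) * ((γ t 1).1 - (γ t 0).1) := rfl
  have e0 : period 0 γ t = u t := hp0.self_of_nhds
  have e1 : period 1 γ t = -I0 t := hp1.self_of_nhds
  have e2 : period 2 γ t = (c t - b t / (2 * a t)) * u t - t₁ t * I0 t + I1 t := hp2.self_of_nhds
  set w := (γ t 1).1 - (γ t 0).1
  have dm : DifferentiableAt ℝ (fun t => c t - b t / (2 * a t)) t := by
    simp only [a, b, c, div_eq_mul_inv]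
    fun_prop (disch := simp [ha'])
  obtain rfl | rfl | rfl : i = 0 ∨ i = 1 ∨ i = 2 := by fin_cases i <;> simp
  · refine hasFDerivAt_of_dirDeriv (D0.congr_of_eventuallyEq hp0).differentiableAt fun τ => ?_
    rw [dirDeriv, (D0.congr_of_eventuallyEq hp0).fderiv]
    simp [(explicitMatrix_apply t τ).1]
  · have hd := hL0.neg.congr_of_eventuallyEq hp1
    refine hasFDerivAt_of_dirDeriv hd.differentiableAt fun τ => ?_
    have hx := explicitMatrix_apply t τ
    change fderiv ℝ (period 1 γ) t τ = (∑ j, period j γ t • explicitMatrix t 1 j) τ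
    rw [hd.fderiv]
    simp only [Fin.sum_univ_three, add_apply, smul_apply, smul_eq_mul, neg_apply, hx.2.1, hx.2.2.1,
      hx.2.2.2.1, e0, e1, e2, hL0τ, hu, boundaryCoeff, A₂₂, A₂₃, sub_apply]
    field_simp
    ring
  · have d1 : DifferentiableAt ℝ t₁ t := by unfold t₁; fun_prop
    have du := D0.differentiableAt
    have dI0 := hL0.differentiableAt
    have dI1 := hL1.differentiableAt
    have hd2 : DifferentiableAt ℝ (fun t => (c t - b t / (2 * a t)) * u t - t₁ t * I0 t + I1 t) t := by
      fun_prop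
    refine hasFDerivAt_of_dirDeriv (hd2.congr_of_eventuallyEq hp2) fun τ => ?_
    have hx := explicitMatrix_apply t τ
    change _ = (∑ j, period j γ t • explicitMatrix t 2 j) τ
    have dm' : dirDeriv τ (fun t => c t - b t / (2 * a t)) t =
        τ 2 - (τ 1 / (2 * a t) - b t * τ 0 / (2 * a t ^ 2)) := by
      simp only [a, b, c]
      rw [dirDeriv_sub (by fun_prop) (by simp only [div_eq_mul_inv]; fun_prop (disch := simp [ha'])),
        dirDeriv_div (by fun_prop) (by fun_prop) (by simp [ha']),
        dirDeriv_mul (by fun_prop) (by fun_prop), dirDeriv_const]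
      simp only [dirDeriv_coord]
      field_simp
      ring
    have h1' : dirDeriv τ t₁ t = τ 3 := dirDeriv_coord 3 τ t
    have h2' : dirDeriv τ u t = 0 := by rw [dirDeriv, D0.fderiv]; simp
    have h3' : dirDeriv τ I0 t = L0 τ := by rw [dirDeriv, hL0.fderiv]
    have h4' : dirDeriv τ I1 t = L1 τ := by rw [dirDeriv, hL1.fderiv]
    rw [dirDeriv_congr hp2]
    change dirDeriv τ (fun t => (c t - b t / (2 * a t)) * u t - t₁ t * I0 t + I1 t) t = _
    rw [dirDeriv_add (by fun_prop) dI1, dirDeriv_sub (by fun_prop) (by fun_prop),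
      dirDeriv_mul dm du, dirDeriv_mul d1 dI0, dm', h1', h2', h3', h4']
    simp only [Fin.sum_univ_three, add_apply, smul_apply, smul_eq_mul, hx.2.2.2.2.1,
      hx.2.2.2.2.2.1, hx.2.2.2.2.2.2, e0, e1, e2, hL0τ, hL1τ, hu, boundaryCoeff', A₃₂, A₃₃,
      sub_apply, dt₁, ContinuousLinearMap.proj_apply]
    field_simp
    ring

end CycleFamily

/-! ### Loops around pairs of branch points -/

/-- The principal branch of the square root, on the plane slit along the negative real axis. -/
def csqrt (z : ℂ) : ℂ := Complex.exp (Complex.log z / 2)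

theorem csqrt_sq {z : ℂ} (hz : z ≠ 0) : csqrt z ^ 2 = z := by
  rw [csqrt, ← Complex.exp_nat_mul]
  simp [mul_div_cancel₀, Complex.exp_log hz]

theorem csqrt_ne_zero (z : ℂ) : csqrt z ≠ 0 := Complex.exp_ne_zero _

theorem csqrt_one : csqrt 1 = 1 := by simp [csqrt]

theorem csqrt_ofReal {x : ℝ} (hx : 0 < x) : csqrt x = (Real.exp (Real.log x / 2) : ℝ) := by
  rw [csqrt, ← Complex.ofReal_log hx.le]
  push_cast
  rfl

theorem contDiffAt_csqrt {z : ℂ} (hz : z ∈ Complex.slitPlane) : ContDiffAt ℂ ∞ csqrt z := by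
  unfold csqrt
  exact ((Complex.contDiffAt_log hz).div_const 2).cexp

theorem contDiffOn_csqrt {H : Type*} [NormedAddCommGroup H] [NormedSpace ℝ H] {Ω : Set H}
    {f : H → ℂ} (hf : ContDiffOn ℝ ∞ f Ω) (h : ∀ z ∈ Ω, f z ∈ Complex.slitPlane) :
    ContDiffOn ℝ ∞ (fun z => csqrt (f z)) Ω := fun z hz =>
  ((contDiffAt_csqrt (h z hz)).restrict_scalars ℝ).comp_contDiffWithinAt z (hf z hz)

theorem contDiff_ofReal {H : Type*} [NormedAddCommGroup H] [NormedSpace ℝ H] {g : H → ℝ}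
    (hg : ContDiff ℝ ∞ g) : ContDiff ℝ ∞ fun z => (g z : ℂ) :=
  Complex.ofRealCLM.contDiff.comp hg

theorem one_sub_mul_mem_slitPlane {l : ℂ} (hl : 1 - l ∈ Complex.slitPlane) {σ : ℝ} (h0 : 0 ≤ σ)
    (h1 : σ ≤ 1) : 1 - l * σ ∈ Complex.slitPlane := by
  have := Complex.starConvex_one_slitPlane hl (sub_nonneg.2 h1) h0 (sub_add_cancel 1 σ)
  convert this using 1
  simp
  ring

theorem sin_sq_mem (s : ℝ) : 0 ≤ Real.sin (Real.pi * s) ^ 2 ∧ Real.sin (Real.pi * s) ^ 2 ≤ 1 :=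
  ⟨sq_nonneg _, Real.sin_sq_le_one _⟩

/-- The product of the square roots of `1 - f u` and `1 - g u` at `u = σ/e`, where `e`, `f` and
`g = -(e + f)` are the roots of the cubic; the arguments are `l = f/e` and `σ`. -/
def rootFactor (l : ℂ) (σ : ℝ) : ℂ := csqrt (1 - l * σ) * csqrt (1 - (-1 - l) * σ)

theorem rootFactor_ne_zero (l : ℂ) (σ : ℝ) : rootFactor l σ ≠ 0 :=
  mul_ne_zero (csqrt_ne_zero _) (csqrt_ne_zero _)

theorem rootFactor_sq {l : ℂ} (h1 : 1 - l ∈ Complex.slitPlane) (h2 : 2 + l ∈ Complex.slitPlane)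
    {σ : ℝ} (s0 : 0 ≤ σ) (s1 : σ ≤ 1) :
    rootFactor l σ ^ 2 = (1 - l * σ) * (1 - (-1 - l) * σ) := by
  have h2' : 1 - (-1 - l) ∈ Complex.slitPlane := by convert h2 using 1; ring
  rw [rootFactor, mul_pow, csqrt_sq (Complex.slitPlane_ne_zero (one_sub_mul_mem_slitPlane h1 s0 s1)),
    csqrt_sq (Complex.slitPlane_ne_zero (one_sub_mul_mem_slitPlane h2' s0 s1))]

theorem contDiffOn_rootFactor {H : Type*} [NormedAddCommGroup H] [NormedSpace ℝ H] {Ω : Set H}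
    {l : H → ℂ} {σ : H → ℝ} (hl : ContDiffOn ℝ ∞ l Ω) (hσ : ContDiffOn ℝ ∞ σ Ω)
    (h1 : ∀ z ∈ Ω, 1 - l z ∈ Complex.slitPlane) (h2 : ∀ z ∈ Ω, 2 + l z ∈ Complex.slitPlane)
    (s0 : ∀ z ∈ Ω, 0 ≤ σ z) (s1 : ∀ z ∈ Ω, σ z ≤ 1) :
    ContDiffOn ℝ ∞ (fun z => rootFactor (l z) (σ z)) Ω := by
  have hσ' : ContDiffOn ℝ ∞ (fun z => (σ z : ℂ)) Ω :=
    Complex.ofRealCLM.contDiff.comp_contDiffOn hσ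
  refine (contDiffOn_csqrt (by fun_prop) fun z hz =>
    one_sub_mul_mem_slitPlane (h1 z hz) (s0 z hz) (s1 z hz)).mul
    (contDiffOn_csqrt (by fun_prop) fun z hz =>
    one_sub_mul_mem_slitPlane ?_ (s0 z hz) (s1 z hz))
  convert h2 z hz using 1
  ring

/-- The coordinate `u = sin²(πs)/e` of the loop that runs from `O` to the branch point `(1/e, 0)`
on one sheet and returns on the other. -/
def loopU (e : ℂ) (s : ℝ) : ℂ := (Real.sin (Real.pi * s) ^ 2 : ℝ) / e

/-- The coordinate `v` of the loop; `r` is a square root of `e` and `l = f/e` the quotient of two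
roots. -/
def loopV (r l : ℂ) (s : ℝ) : ℂ :=
  2 * (Real.sin (Real.pi * s) : ℝ) * (Real.cos (Real.pi * s) : ℝ) / r *
    rootFactor l (Real.sin (Real.pi * s) ^ 2)

/-- The pullback of `du/v` to the loop. -/
def loopTheta (r l : ℂ) (s : ℝ) : ℂ :=
  Real.pi / (r * rootFactor l (Real.sin (Real.pi * s) ^ 2))

/-- The roots `e`, `f` and `-(e + f)` of the cubic `4x³ - p₂x - p₃`, depending on a parameter,
with a square root `r` of `e`. The segment from `0` to `1/e` contains no other branch point. -/
structure IsRootFamily {E : Type*} [NormedAddCommGroup E] [NormedSpace ℝ E] (W : Set E)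
    (p₂ p₃ e f r : E → ℂ) : Prop where
  isOpen : IsOpen W
  smooth_e : ContDiffOn ℝ ∞ e W
  smooth_f : ContDiffOn ℝ ∞ f W
  smooth_r : ContDiffOn ℝ ∞ r W
  smooth₂ : ContDiffOn ℝ ∞ p₂ W
  smooth₃ : ContDiffOn ℝ ∞ p₃ W
  eq₂ : ∀ x ∈ W, p₂ x = 4 * (e x ^ 2 + e x * f x + f x ^ 2)
  eq₃ : ∀ x ∈ W, p₃ x = -4 * e x * f x * (e x + f x)
  disc_ne : ∀ x ∈ W, discOf (p₂ x) (p₃ x) ≠ 0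
  ne_zero : ∀ x ∈ W, e x ≠ 0
  sq_eq : ∀ x ∈ W, r x ^ 2 = e x
  mem₁ : ∀ x ∈ W, 1 - f x / e x ∈ Complex.slitPlane
  mem₂ : ∀ x ∈ W, 2 + f x / e x ∈ Complex.slitPlane

/-- The value of `∫ du/v` over the loop. -/
def loopInt₀ (r l : ℂ) : ℂ := ∫ s in (0 : ℝ)..1, loopTheta r l s

/-- The value of `∫ h du/v` over the loop. -/
def loopInt₁ (p₂ p₃ e r l : ℂ) : ℂ :=
  ∫ s in (0 : ℝ)..1, weight p₂ p₃ (loopU e s) * loopTheta r l s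

namespace IsRootFamily

variable {E : Type*} [NormedAddCommGroup E] [NormedSpace ℝ E] {W : Set E} {p₂ p₃ e f r : E → ℂ}

theorem r_ne_zero (h : IsRootFamily W p₂ p₃ e f r) {x : E} (hx : x ∈ W) : r x ≠ 0 := by
  intro h0
  have := h.sq_eq x hx
  rw [h0] at this
  exact h.ne_zero x hx (by simpa using this.symm)

theorem contDiffOn_ratio (h : IsRootFamily W p₂ p₃ e f r) :
    ContDiffOn ℝ ∞ (fun x => f x / e x) W := by
  simp only [div_eq_mul_inv]
  exact h.smooth_f.mul (h.smooth_e.inv h.ne_zero)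

theorem isCurveFamily (h : IsRootFamily W p₂ p₃ e f r) :
    IsCurveFamily W p₂ p₃ (fun z => loopU (e z.1) z.2) (fun z => loopV (r z.1) (f z.1 / e z.1) z.2)
    where
  isOpen := h.isOpen
  smooth₂ := h.smooth₂
  smooth₃ := h.smooth₃
  smoothU := by
    have hs : ContDiff ℝ ∞ fun z : E × ℝ => ((Real.sin (Real.pi * z.2) ^ 2 : ℝ) : ℂ) :=
      contDiff_ofReal (by fun_prop)
    simp only [loopU, div_eq_mul_inv]
    exact hs.contDiffOn.mul ((h.smooth_e.comp contDiffOn_fst fun _ hz => hz.1).inv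
      fun z hz => h.ne_zero z.1 hz.1)
  smoothV := by
    have hs : ContDiff ℝ ∞ fun z : E × ℝ => ((Real.sin (Real.pi * z.2) : ℝ) : ℂ) :=
      contDiff_ofReal (by fun_prop)
    have hc : ContDiff ℝ ∞ fun z : E × ℝ => ((Real.cos (Real.pi * z.2) : ℝ) : ℂ) :=
      contDiff_ofReal (by fun_prop)
    simp only [loopV]
    refine ContDiffOn.mul ?_ (contDiffOn_rootFactor
      (h.contDiffOn_ratio.comp contDiffOn_fst fun _ hz => hz.1) (by fun_prop)
      (fun z hz => h.mem₁ z.1 hz.1) (fun z hz => h.mem₂ z.1 hz.1)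
      (fun z _ => (sin_sq_mem z.2).1) (fun z _ => (sin_sq_mem z.2).2))
    simp only [div_eq_mul_inv]
    exact ((contDiffOn_const.mul hs.contDiffOn).mul hc.contDiffOn).mul
      ((h.smooth_r.comp contDiffOn_fst fun _ hz => hz.1).inv fun z hz => h.r_ne_zero hz.1)
  disc_ne := h.disc_ne
  curve := by
    intro x hx s _
    have he := h.ne_zero x hx
    have hr := h.r_ne_zero hx
    have h2 : ((Real.cos (Real.pi * s) : ℝ) : ℂ) ^ 2 = 1 - ((Real.sin (Real.pi * s) : ℝ) : ℂ) ^ 2 := by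
      norm_cast
      exact Real.cos_sq' _
    rw [loopV, mul_pow, rootFactor_sq (h.mem₁ x hx) (h.mem₂ x hx) (sin_sq_mem s).1 (sin_sq_mem s).2,
      div_pow, mul_pow, h2, h.sq_eq x hx, quarticOf, loopU, h.eq₂ x hx, h.eq₃ x hx]
    push_cast
    field_simp
    ring

theorem loopU_hasDerivAt (e : ℂ) (s : ℝ) : HasDerivAt (loopU e)
    (2 * Real.pi * (Real.sin (Real.pi * s) : ℝ) * (Real.cos (Real.pi * s) : ℝ) / e) s := by
  have h := ((((hasDerivAt_id s).const_mul Real.pi).sin.pow 2).ofReal_comp.div_const e)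
  refine h.congr_deriv ?_
  simp
  ring

/-- Along the loop, `du/v` is `loopTheta` except at the branch points. -/
theorem familyTheta_eq (h : IsRootFamily W p₂ p₃ e f r) {x : E} (hx : x ∈ W) {s : ℝ}
    (hs : s ∈ Set.Ioo (0 : ℝ) 1) (hs' : s ≠ 1 / 2) :
    familyTheta p₂ p₃ (fun z => loopU (e z.1) z.2) (fun z => loopV (r z.1) (f z.1 / e z.1) z.2)
      (x, s) = loopTheta (r x) (f x / e x) s := by
  have he := h.ne_zero x hx
  have hr := h.r_ne_zero hx
  have hF := rootFactor_ne_zero (f x / e x) (Real.sin (Real.pi * s) ^ 2)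
  have h1 := (h.isCurveFamily.theta_spec hx hs).1
  have hU := (hasDerivAt_right (h.isCurveFamily.differentiableAt h.isCurveFamily.smoothU hx s)).unique
    (loopU_hasDerivAt (e x) s)
  rw [hU] at h1
  have hpi := Real.pi_pos
  have hsin : (Real.sin (Real.pi * s) : ℂ) ≠ 0 := by
    exact_mod_cast (Real.sin_pos_of_pos_of_lt_pi (by nlinarith [hs.1]) (by nlinarith [hs.2])).ne'
  have hcos : (Real.cos (Real.pi * s) : ℂ) ≠ 0 := by
    intro h0
    have h0' : Real.cos (Real.pi * s) = Real.cos (Real.pi / 2) := by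
      rw [Real.cos_pi_div_two]; exact_mod_cast h0
    have := Real.injOn_cos ⟨by nlinarith [hs.1], by nlinarith [hs.2]⟩
      ⟨by positivity, by linarith⟩ h0'
    exact hs' (by field_simp at this; linarith)
  have hV : loopV (r x) (f x / e x) s ≠ 0 :=
    mul_ne_zero (div_ne_zero (mul_ne_zero (mul_ne_zero two_ne_zero hsin) hcos) hr) hF
  apply mul_left_cancel₀ hV
  refine h1.trans ?_
  rw [loopV, loopTheta]
  generalize rootFactor (f x / e x) (Real.sin (Real.pi * s) ^ 2) = F at hF
  rw [← h.sq_eq x hx]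
  field_simp

theorem integral_familyTheta (h : IsRootFamily W p₂ p₃ e f r) {x : E} (hx : x ∈ W) :
    ∫ s in (0 : ℝ)..1, familyTheta p₂ p₃ (fun z => loopU (e z.1) z.2)
      (fun z => loopV (r z.1) (f z.1 / e z.1) z.2) (x, s) = loopInt₀ (r x) (f x / e x) ∧
    ∫ s in (0 : ℝ)..1, weight (p₂ x) (p₃ x) (loopU (e x) s) *
      familyTheta p₂ p₃ (fun z => loopU (e z.1) z.2)
      (fun z => loopV (r z.1) (f z.1 / e z.1) z.2) (x, s) =
      loopInt₁ (p₂ x) (p₃ x) (e x) (r x) (f x / e x) := by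
  have hae : ∀ k : ℝ, ∀ᵐ s : ℝ, s ≠ k := fun k =>
    MeasureTheory.compl_mem_ae_iff.2 (MeasureTheory.measure_singleton k)
  have hI : ∀ {s : ℝ}, s ∈ Set.uIoc (0 : ℝ) 1 → s ≠ 1 → s ∈ Set.Ioo (0 : ℝ) 1 := by
    intro s hs h1
    rw [Set.uIoc_of_le zero_le_one] at hs
    exact ⟨hs.1, lt_of_le_of_ne hs.2 h1⟩
  constructor <;>
  · refine intervalIntegral.integral_congr_ae ?_
    filter_upwards [hae (1 / 2), hae 1] with s h2 h1 hs
    rw [h.familyTheta_eq hx (hI hs h1) h2]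

theorem loop_end (r l e : ℂ) {s : ℝ} (hs : s = 0 ∨ s = 1) : loopU e s = 0 ∧ loopV r l s = 0 := by
  have : Real.sin (Real.pi * s) = 0 := by rcases hs with rfl | rfl <;> simp
  simp [loopU, loopV, this]

theorem boundary_eq_zero (h : IsRootFamily W p₂ p₃ e f r) {x : E} (hx : x ∈ W) {s : ℝ}
    (hs : s = 0 ∨ s = 1) (τ : E) :
    familyContraction τ p₂ p₃ (fun z => loopU (e z.1) z.2)
      (fun z => loopV (r z.1) (f z.1 / e z.1) z.2) (x, s) = 0 ∧
    IsCurveFamily.boundary τ p₂ p₃ (fun z => loopU (e z.1) z.2)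
      (fun z => loopV (r z.1) (f z.1 / e z.1) z.2) x (x, s) = 0 := by
  have h2 := (h.isCurveFamily.contraction_spec hx (s := s)
    (by rcases hs with rfl | rfl <;> simp) τ).2
  have hV : fderiv ℝ (fun y => loopV (r y) (f y / e y) s) x τ = 0 := by
    have : (fun y => loopV (r y) (f y / e y) s) = fun _ => 0 :=
      funext fun y => (loop_end (r y) (f y / e y) 0 hs).2
    rw [this]
    simp
  simp only [hV] at h2
  rw [(loop_end (r x) (f x / e x) (e x) hs).1, (loop_end (r x) (f x / e x) (e x) hs).2] at h2
  have hG := contraction_eq_zero h2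
  refine ⟨hG, ?_⟩
  simp [IsCurveFamily.boundary, hG, (loop_end (r x) (f x / e x) (e x) hs).2]

/-- The Gauss-Manin equations for the periods of the loop. -/
theorem hasFDerivAt_loopInt (h : IsRootFamily W p₂ p₃ e f r) {x : E} (hx : x ∈ W) :
    ∃ L₀ L₁ : E →L[ℝ] ℂ, HasFDerivAt (fun x => loopInt₀ (r x) (f x / e x)) L₀ x ∧
      HasFDerivAt (fun x => loopInt₁ (p₂ x) (p₃ x) (e x) (r x) (f x / e x)) L₁ x ∧
      ∀ τ, L₀ τ = (-(discDerivOf (p₂ x) (p₃ x) (fderiv ℝ p₂ x τ) (fderiv ℝ p₃ x τ) / 12) *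
            loopInt₀ (r x) (f x / e x) -
          3 / 2 * alphaOf (p₂ x) (p₃ x) (fderiv ℝ p₂ x τ) (fderiv ℝ p₃ x τ) *
            loopInt₁ (p₂ x) (p₃ x) (e x) (r x) (f x / e x)) / discOf (p₂ x) (p₃ x) ∧
        L₁ τ = (p₂ x / 8 * alphaOf (p₂ x) (p₃ x) (fderiv ℝ p₂ x τ) (fderiv ℝ p₃ x τ) *
            loopInt₀ (r x) (f x / e x) +
          discDerivOf (p₂ x) (p₃ x) (fderiv ℝ p₂ x τ) (fderiv ℝ p₃ x τ) / 12 *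
            loopInt₁ (p₂ x) (p₃ x) (e x) (r x) (f x / e x)) / discOf (p₂ x) (p₃ x) := by
  obtain ⟨L₀, hL₀, hL₀τ⟩ := h.isCurveFamily.hasFDerivAt_theta hx
  obtain ⟨L₁, hL₁, hL₁τ⟩ := h.isCurveFamily.hasFDerivAt_weight_mul_theta hx
  simp only [(h.integral_familyTheta hx).1, (h.integral_familyTheta hx).2,
    (h.boundary_eq_zero hx (Or.inl rfl) _).1, (h.boundary_eq_zero hx (Or.inr rfl) _).1,
    (h.boundary_eq_zero hx (Or.inl rfl) _).2, (h.boundary_eq_zero hx (Or.inr rfl) _).2,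
    sub_zero, add_zero] at hL₀τ hL₁τ
  refine ⟨L₀, L₁, hL₀.congr_of_eventuallyEq ?_, hL₁.congr_of_eventuallyEq ?_,
    fun τ => ⟨hL₀τ τ, hL₁τ τ⟩⟩
  · filter_upwards [h.isOpen.mem_nhds hx] with y hy using (h.integral_familyTheta hy).1.symm
  · filter_upwards [h.isOpen.mem_nhds hx] with y hy using (h.integral_familyTheta hy).2.symm

end IsRootFamily

/-! ### Linear independence of the periods of two loops -/

/-- The region of nonzero quotients `l = f/e` of two roots for which neither `l` nor `-1 - l` nor
their analogues `1/l` and `-1 - 1/l` for the exchanged roots lie in `[1, ∞)`: the plane without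
`(-∞, -2]` and `[-1/2, ∞)`. -/
def rootRegion : Set ℂ := {l | 2 + l ∈ Complex.slitPlane ∧ -1 - 2 * l ∈ Complex.slitPlane}

theorem isOpen_rootRegion : IsOpen rootRegion :=
  (Complex.isOpen_slitPlane.preimage (by fun_prop : Continuous fun l : ℂ => 2 + l)).inter
    (Complex.isOpen_slitPlane.preimage (by fun_prop : Continuous fun l : ℂ => -1 - 2 * l))

/-- The region is star-shaped about the value `-1` of the lemniscatic curve. -/
theorem segment_mem_rootRegion {l : ℂ} (hl : l ∈ rootRegion) {x : ℝ} (h0 : 0 ≤ x) (h1 : x ≤ 1) :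
    (1 - x) * l - x ∈ rootRegion := by
  have ha := Complex.starConvex_one_slitPlane hl.1 h0 (sub_nonneg.2 h1) (add_sub_cancel x 1)
  have hb := Complex.starConvex_one_slitPlane hl.2 h0 (sub_nonneg.2 h1) (add_sub_cancel x 1)
  refine ⟨?_, ?_⟩
  · convert ha using 1; simp; ring
  · convert hb using 1; simp; ring

theorem rootRegion_spec {l : ℂ} (hl : l ∈ rootRegion) :
    l ≠ 0 ∧ 1 - l ∈ Complex.slitPlane ∧ -l ∈ Complex.slitPlane ∧ 1 - l⁻¹ ∈ Complex.slitPlane ∧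
      2 + l⁻¹ ∈ Complex.slitPlane := by
  obtain ⟨h1, h2⟩ := hl
  simp only [Complex.mem_slitPlane_iff] at *
  by_cases him : l.im = 0
  · obtain ⟨x, rfl⟩ : ∃ x : ℝ, l = x := ⟨l.re, Complex.ext rfl (by simp [him])⟩
    simp at h1 h2
    have hx : x < 0 := by linarith
    have hi : x⁻¹ * x = 1 := inv_mul_cancel₀ hx.ne
    have hx' : x⁻¹ < 0 := inv_lt_zero.2 hx
    refine ⟨by exact_mod_cast hx.ne, Or.inl ?_, Or.inl ?_, Or.inl ?_, Or.inl ?_⟩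
    · simp; linarith
    · simpa using hx
    · rw [← Complex.ofReal_inv]; simp; linarith
    · rw [← Complex.ofReal_inv]; simp; nlinarith
  · have h0 : l ≠ 0 := by rintro rfl; simp at him
    refine ⟨h0, Or.inr ?_, Or.inr ?_, Or.inr ?_, Or.inr ?_⟩ <;> simp [him, h0]

theorem discOf_roots (e f : ℂ) :
    discOf (4 * (e ^ 2 + e * f + f ^ 2)) (-4 * e * f * (e + f)) =
      -16 * ((e - f) * (2 * e + f) * (e + 2 * f)) ^ 2 := by
  rw [discOf]; ring

/-- The determinant of the periods of `du/v` and `h du/v` over the loops to two branch points. -/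
def loopDet (p₂ p₃ e f r r' : ℂ) : ℂ :=
  loopInt₀ r (f / e) * loopInt₁ p₂ p₃ f r' (e / f) -
    loopInt₁ p₂ p₃ e r (f / e) * loopInt₀ r' (e / f)

/-- The Gauss-Manin matrix of the absolute periods has trace zero, so that their determinant is
constant. -/
theorem hasDerivAt_loopDet {W : Set ℝ} {p₂ p₃ e f r r' : ℝ → ℂ}
    (h : IsRootFamily W p₂ p₃ e f r) (h' : IsRootFamily W p₂ p₃ f e r') {x : ℝ} (hx : x ∈ W) :
    HasDerivAt (fun x => loopDet (p₂ x) (p₃ x) (e x) (f x) (r x) (r' x)) 0 x := by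
  obtain ⟨L₀, L₁, h₀, h₁, hL⟩ := h.hasFDerivAt_loopInt hx
  obtain ⟨L₀', L₁', h₀', h₁', hL'⟩ := h'.hasFDerivAt_loopInt hx
  have hd := (h₀.hasDerivAt.mul h₁'.hasDerivAt).sub (h₁.hasDerivAt.mul h₀'.hasDerivAt)
  refine hd.congr_deriv ?_
  rw [(hL 1).1, (hL 1).2, (hL' 1).1, (hL' 1).2]
  ring

theorem rootFactor_neg_one {σ : ℝ} (h : 0 ≤ σ) :
    rootFactor (-1) σ = (Real.exp (Real.log (1 + σ) / 2) : ℝ) := by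
  rw [rootFactor, ← csqrt_ofReal (by linarith)]
  simp [csqrt_one]

/-- For the lemniscatic curve (`f = -e`) the periods are multiples of integrals of positive
functions, and the determinant does not vanish. -/
theorem loopDet_lemniscatic_ne_zero {e r r' : ℂ} (he : e ≠ 0) (hr : r ≠ 0) (hr' : r' ≠ 0) :
    loopDet (4 * e ^ 2) 0 e (-e) r r' ≠ 0 := by
  let g : ℝ → ℝ := fun s => Real.exp (Real.log (1 + Real.sin (Real.pi * s) ^ 2) / 2)
  have hg : ∀ s, 0 < g s := fun s => Real.exp_pos _
  have hgc : Continuous g := by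
    have : ∀ s : ℝ, 1 + Real.sin (Real.pi * s) ^ 2 ≠ 0 := fun s => by positivity
    fun_prop (disch := assumption)
  have hF : ∀ s, rootFactor (-1) (Real.sin (Real.pi * s) ^ 2) = (g s : ℝ) := fun s =>
    rootFactor_neg_one (sin_sq_mem s).1
  set I : ℝ := ∫ s in (0 : ℝ)..1, Real.pi / g s
  set J : ℝ := ∫ s in (0 : ℝ)..1, Real.sin (Real.pi * s) ^ 2 * (Real.pi / g s)
  have cI : Continuous fun s => Real.pi / g s := continuous_const.div hgc fun s => (hg s).ne'
  have hI : 0 < I := intervalIntegral.intervalIntegral_pos_of_pos (cI.intervalIntegrable _ _)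
    (fun s => div_pos Real.pi_pos (hg s)) one_pos
  have hJ : 0 < J := by
    refine intervalIntegral.intervalIntegral_pos_of_pos_on
      (Continuous.intervalIntegrable (by fun_prop) _ _) (fun s hs => ?_) one_pos
    have : 0 < Real.sin (Real.pi * s) := Real.sin_pos_of_pos_of_lt_pi
      (mul_pos Real.pi_pos hs.1) (by nlinarith [hs.2, Real.pi_pos])
    exact mul_pos (pow_pos this 2) (div_pos Real.pi_pos (hg s))
  have i0 : ∀ r : ℂ, loopInt₀ r (-1) = r⁻¹ * I := by
    intro r
    rw [← intervalIntegral.integral_ofReal, ← intervalIntegral.integral_const_mul]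
    refine intervalIntegral.integral_congr fun s _ => ?_
    simp only [loopTheta, hF]
    push_cast
    rw [mul_comm r, ← div_div]
    ring
  have i1 : ∀ r k : ℂ, loopInt₁ (4 * e ^ 2) 0 k r (-1) = e ^ 2 / k * r⁻¹ * J := by
    intro r k
    rw [← intervalIntegral.integral_ofReal, ← intervalIntegral.integral_const_mul]
    refine intervalIntegral.integral_congr fun s _ => ?_
    simp only [loopTheta, hF, weight, loopU]
    push_cast
    rw [mul_comm r, ← div_div]
    ring
  have e1 : -e / e = -1 := by field_simp
  have e2 : e / -e = -1 := by field_simp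
  rw [loopDet, e1, e2, i0, i0, i1, i1]
  have hI' : (I : ℂ) ≠ 0 := by exact_mod_cast hI.ne'
  have hJ' : (J : ℂ) ≠ 0 := by exact_mod_cast hJ.ne'
  have : r⁻¹ * I * (e ^ 2 / -e * r'⁻¹ * J) - e ^ 2 / e * r⁻¹ * J * (r'⁻¹ * I) =
      -2 * e * I * J / (r * r') := by
    field_simp
    ring
  rw [this]
  exact div_ne_zero (mul_ne_zero (mul_ne_zero (mul_ne_zero (by norm_num) he) hI') hJ')
    (mul_ne_zero hr hr')

/-- The periods of the two loops are linearly independent: their determinant is constant along the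
segment from the quotient of the roots to the lemniscatic value. -/
theorem loopDet_ne_zero {e f r r' : ℂ} (he : e ≠ 0) (hr : r ^ 2 = e) (hr' : r' ^ 2 = f)
    (hl : f / e ∈ rootRegion) :
    loopDet (4 * (e ^ 2 + e * f + f ^ 2)) (-4 * e * f * (e + f)) e f r r' ≠ 0 := by
  set l₀ := f / e with hl₀
  have hf : f = e * l₀ := by rw [hl₀]; field_simp
  obtain ⟨hl0, -, hln, -⟩ := rootRegion_spec hl
  have hf0 : f ≠ 0 := by rw [hf]; exact mul_ne_zero he hl0
  have hr0 : r ≠ 0 := by rintro rfl; exact he (by simpa using hr.symm)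
  have hr0' : r' ≠ 0 := by rintro rfl; exact hf0 (by simpa using hr'.symm)
  -- `e` stays fixed and `f = e l` moves to `-e`; `-l` remains in the slit plane, which gives a
  -- continuous square root `R` of `f`
  let l : ℝ → ℂ := fun x => (1 - x) * l₀ - x
  let W : Set ℝ := l ⁻¹' rootRegion
  let F : ℝ → ℂ := fun x => e * l x
  let R : ℝ → ℂ := fun x => csqrt (-l x) * (r' / csqrt (-l₀))
  let P : ℝ → ℂ := fun x => 4 * (e ^ 2 + e * F x + F x ^ 2)
  let Q : ℝ → ℂ := fun x => -4 * e * F x * (e + F x)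
  have hlc : ContDiff ℝ ∞ l := by
    have : ContDiff ℝ ∞ fun x : ℝ => (x : ℂ) := contDiff_ofReal (by fun_prop)
    fun_prop
  have hW : IsOpen W := isOpen_rootRegion.preimage hlc.continuous
  have hFc : ContDiff ℝ ∞ F := by fun_prop
  have hFe : ∀ x, F x / e = l x := fun x => by simp only [F]; field_simp
  have heF : ∀ x, e / F x = (l x)⁻¹ := fun x => by rw [← hFe, inv_div]
  have hdisc : ∀ x ∈ W, discOf (P x) (Q x) ≠ 0 := by
    intro x hx
    have h1 := Complex.slitPlane_ne_zero (rootRegion_spec hx).2.1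
    have h2 := Complex.slitPlane_ne_zero hx.1
    have h3 := Complex.slitPlane_ne_zero hx.2
    simp only [P, Q, discOf_roots]
    have : (e - F x) * (2 * e + F x) * (e + 2 * F x) =
        -(e ^ 3 * ((1 - l x) * (2 + l x) * (-1 - 2 * l x))) := by
      simp only [F]; ring
    rw [this]
    exact mul_ne_zero (by norm_num) (pow_ne_zero 2 (neg_ne_zero.2 (mul_ne_zero (pow_ne_zero 3 he)
      (mul_ne_zero (mul_ne_zero h1 h2) h3))))
  have A : IsRootFamily W P Q (fun _ => e) F (fun _ => r) :=
    { isOpen := hW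
      smooth_e := contDiffOn_const
      smooth_f := hFc.contDiffOn
      smooth_r := contDiffOn_const
      smooth₂ := by fun_prop
      smooth₃ := by fun_prop
      eq₂ := fun x _ => rfl
      eq₃ := fun x _ => rfl
      disc_ne := hdisc
      ne_zero := fun _ _ => he
      sq_eq := fun _ _ => hr
      mem₁ := fun x hx => by simp only [hFe]; exact (rootRegion_spec hx).2.1
      mem₂ := fun x hx => by simp only [hFe]; exact hx.1 }
  have B : IsRootFamily W P Q F (fun _ => e) R :=
    { isOpen := hW
      smooth_e := hFc.contDiffOn
      smooth_f := contDiffOn_const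
      smooth_r := (contDiffOn_csqrt hlc.neg.contDiffOn fun x hx =>
        (rootRegion_spec hx).2.2.1).mul contDiffOn_const
      smooth₂ := by fun_prop
      smooth₃ := by fun_prop
      eq₂ := fun x _ => by simp only [P]; ring
      eq₃ := fun x _ => by simp only [Q]; ring
      disc_ne := hdisc
      ne_zero := fun x hx => mul_ne_zero he (rootRegion_spec hx).1
      sq_eq := fun x hx => by
        simp only [R, F]
        rw [mul_pow, div_pow, csqrt_sq (neg_ne_zero.2 (rootRegion_spec hx).1),
          csqrt_sq (neg_ne_zero.2 hl0), hr', hf]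
        field_simp
      mem₁ := fun x hx => by simp only [heF]; exact (rootRegion_spec hx).2.2.2.1
      mem₂ := fun x hx => by simp only [heF]; exact (rootRegion_spec hx).2.2.2.2 }
  have hseg : ∀ x ∈ Set.Icc (0 : ℝ) 1, x ∈ W := fun x hx => segment_mem_rootRegion hl hx.1 hx.2
  have key := constant_of_has_deriv_right_zero
    (f := fun x => loopDet (P x) (Q x) e (F x) r (R x)) (a := 0) (b := 1)
    (fun x hx => (hasDerivAt_loopDet A B (hseg x hx)).continuousAt.continuousWithinAt)
    (fun x hx => (hasDerivAt_loopDet A B (hseg x ⟨hx.1, hx.2.le⟩)).hasDerivWithinAt) 1 (by simp)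
  have F0 : F 0 = f := by simp [F, l, hf]
  have R0 : R 0 = r' := by
    simp only [R, l]
    have := csqrt_ne_zero (-l₀)
    simp only [Complex.ofReal_zero, sub_zero, one_mul]
    field_simp
  have F1 : F 1 = -e := by simp [F, l]
  simp only [P, Q, F0, R0, F1] at key
  rw [← key]
  have h1 : 4 * (e ^ 2 + e * -e + (-e) ^ 2) = 4 * e ^ 2 := by ring
  have h2 : -4 * e * -e * (e + -e) = 0 := by ring
  rw [h1, h2]
  exact loopDet_lemniscatic_ne_zero he hr0 (mul_ne_zero (csqrt_ne_zero _)
    (div_ne_zero hr0' (csqrt_ne_zero _)))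

/-! ### Local families of loops -/

/-- `e`, `f` and `-(e + f)` are the roots of `4x³ - t₂x - t₃`. -/
def AreRoots (t : Param) (e f : ℂ) : Prop :=
  t₂ t = 4 * (e ^ 2 + e * f + f ^ 2) ∧ t₃ t = -4 * e * f * (e + f)

theorem AreRoots.ne {t : Param} {e f : ℂ} (h : AreRoots t e f) (ht : t ∈ Base) :
    e - f ≠ 0 ∧ 2 * e + f ≠ 0 ∧ e + 2 * f ≠ 0 := by
  have hd : discOf (t₂ t) (t₃ t) ≠ 0 := ht.2.2
  rw [h.1, h.2, discOf_roots] at hd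
  refine ⟨?_, ?_, ?_⟩ <;> (intro h0; rw [h0] at hd; simp at hd)

theorem AreRoots.root {t : Param} {e f : ℂ} (h : AreRoots t e f) :
    4 * e ^ 3 - t₂ t * e - t₃ t = 0 := by
  rw [h.1, h.2]; ring

theorem AreRoots.symm {t : Param} {e f : ℂ} (h : AreRoots t e f) : AreRoots t f e :=
  ⟨by rw [h.1]; ring, by rw [h.2]; ring⟩

theorem AreRoots.third {t : Param} {e f : ℂ} (h : AreRoots t e f) : AreRoots t e (-(e + f)) :=
  ⟨by rw [h.1]; ring, by rw [h.2]; ring⟩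

theorem areRoots_of_ne {t : Param} {e f : ℂ} (he : 4 * e ^ 3 - t₂ t * e - t₃ t = 0)
    (hf : 4 * f ^ 3 - t₂ t * f - t₃ t = 0) (hef : e - f ≠ 0) : AreRoots t e f := by
  have h2 : t₂ t = 4 * (e ^ 2 + e * f + f ^ 2) := by
    apply mul_left_cancel₀ hef
    linear_combination hf - he
  refine ⟨h2, ?_⟩
  rw [h2] at he
  linear_combination -he

theorem exists_areRoots (t : Param) : ∃ e f, AreRoots t e f := by
  obtain ⟨e, he⟩ : ∃ e : ℂ, 4 * e ^ 3 - t₂ t * e - t₃ t = 0 := by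
    let p : Cubic ℂ := ⟨4, 0, -t₂ t, -t₃ t⟩
    have hp : p.toPoly.degree = 3 := Cubic.degree_of_a_ne_zero (by norm_num [p])
    obtain ⟨e, he⟩ := IsAlgClosed.exists_root p.toPoly (by rw [hp]; norm_num)
    refine ⟨e, ?_⟩
    simp [p, Cubic.toPoly] at he
    linear_combination he
  obtain ⟨d, hd⟩ := IsAlgClosed.exists_pow_nat_eq (t₂ t - 3 * e ^ 2) (n := 2) (by norm_num)
  have h2 : t₂ t = 4 * (e ^ 2 + e * ((-e + d) / 2) + ((-e + d) / 2) ^ 2) := by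
    linear_combination -hd
  refine ⟨e, (-e + d) / 2, h2, ?_⟩
  rw [h2] at he
  linear_combination -he

/-- The roots can be ordered by decreasing modulus. -/
theorem exists_areRoots_ordered (t : Param) :
    ∃ e f, AreRoots t e f ∧ ‖f‖ ≤ ‖e‖ ∧ ‖e + f‖ ≤ ‖f‖ := by
  obtain ⟨e, f, h⟩ := exists_areRoots t
  have hg : ‖-(e + f)‖ = ‖e + f‖ := norm_neg _
  have h1 : ‖e + -(e + f)‖ = ‖f‖ := by rw [← norm_neg f]; congr 1; ring
  have h2 : ‖f + -(e + f)‖ = ‖e‖ := by rw [← norm_neg e]; congr 1; ring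
  have h3 := h.symm.third
  rw [add_comm f e] at h3
  rcases le_total ‖e‖ ‖f‖ with ef | ef <;> rcases le_total ‖e‖ ‖e + f‖ with eg | eg <;>
    rcases le_total ‖f‖ ‖e + f‖ with fg | fg
  · exact ⟨-(e + f), f, h3.symm, by rwa [hg], by rwa [add_comm, h2]⟩
  · exact ⟨f, -(e + f), h3, by rwa [hg], by rwa [h2, hg]⟩
  · exact ⟨-(e + f), f, h3.symm, by rwa [hg], by rwa [add_comm, h2]⟩
  · exact ⟨f, e, h.symm, ef, by rwa [add_comm]⟩
  · exact ⟨-(e + f), e, h.third.symm, by rwa [hg], by rwa [add_comm, h1]⟩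
  · exact ⟨-(e + f), e, h.third.symm, by rwa [hg], by rwa [add_comm, h1]⟩
  · exact ⟨e, -(e + f), h.third, by rwa [hg], by rwa [h1, hg]⟩
  · exact ⟨e, f, h, ef, fg⟩

theorem AreRoots.ratio_mem {t : Param} (ht : t ∈ Base) {e f : ℂ} (h : AreRoots t e f)
    (h1 : ‖f‖ ≤ ‖e‖) (h2 : ‖e + f‖ ≤ ‖f‖) : e ≠ 0 ∧ f / e ∈ rootRegion := by
  obtain ⟨n1, n2, n3⟩ := h.ne ht
  have he : e ≠ 0 := by
    rintro rfl
    have : f = 0 := by simpa using h1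
    simp [this] at n1
  have hpos : 0 < ‖e‖ := norm_pos_iff.2 he
  set l := f / e with hl
  have hf : f = e * l := by rw [hl]; field_simp
  have l1 : ‖l‖ ≤ 1 := by rw [hl, norm_div]; exact (div_le_one hpos).2 h1
  have l2 : ‖1 + l‖ ≤ ‖l‖ := by
    have e1 : e + f = e * (1 + l) := by rw [hf]; ring
    rw [e1, hf, norm_mul, norm_mul] at h2
    exact le_of_mul_le_mul_left h2 hpos
  have hre : -1 ≤ l.re := (abs_le.1 ((Complex.abs_re_le_norm l).trans l1)).1
  have hsq : ‖1 + l‖ ^ 2 ≤ ‖l‖ ^ 2 := pow_le_pow_left₀ (norm_nonneg _) l2 2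
  rw [← Complex.normSq_eq_norm_sq, ← Complex.normSq_eq_norm_sq, Complex.normSq_apply,
    Complex.normSq_apply] at hsq
  simp at hsq
  refine ⟨he, ?_, ?_⟩
  · rw [Complex.mem_slitPlane_iff]
    left
    simp
    linarith
  · rw [Complex.mem_slitPlane_iff]
    by_cases him : l.im = 0
    · left
      simp
      rcases (show l.re ≤ -1 / 2 by nlinarith).lt_or_eq with h | h
      · linarith
      · exfalso
        have : l = -1 / 2 := Complex.ext (by simp [h]) (by simp [him])
        rw [hf, this] at n3
        apply n3
        ring
    · right
      simpa using him

/-- A simple root of the cubic is locally a holomorphic function of the parameters. -/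
theorem exists_local_root {t : Param} {e : ℂ} (he : 4 * e ^ 3 - t₂ t * e - t₃ t = 0)
    (hd : 12 * e ^ 2 - t₂ t ≠ 0) : ∃ φ : Param → ℂ, φ t = e ∧ ContDiffAt ℂ ω φ t ∧
      ∀ᶠ y in 𝓝 t, 4 * φ y ^ 3 - t₂ y * φ y - t₃ y = 0 := by
  let F : Param × ℂ → ℂ := fun z => 4 * z.2 ^ 3 - t₂ z.1 * z.2 - t₃ z.1
  have hF : ContDiffAt ℂ ω F (t, e) := by
    simp only [F, t₃, a, b, t₂]
    fun_prop
  have hi : (fderiv ℂ F (t, e) ∘L .inr ℂ Param ℂ).IsInvertible := by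
    refine ⟨ContinuousLinearEquiv.unitsEquivAut ℂ (Units.mk0 _ hd), ?_⟩
    have h1 : HasFDerivAt (fun x => F (t, x)) (fderiv ℂ F (t, e) ∘L .inr ℂ Param ℂ) e :=
      HasFDerivAt.comp e (g := F) (hF.differentiableAt (by simp)).hasFDerivAt
        (hasFDerivAt_prodMk_right t e)
    have h2 : HasDerivAt (fun x => F (t, x)) _ e :=
      ((((hasDerivAt_id e).fun_pow 3).const_mul 4).fun_sub
        ((hasDerivAt_id e).const_mul (t₂ t))).sub_const (t₃ t)
    rw [h1.unique h2.hasFDerivAt]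
    ext
    simp
    ring
  refine ⟨hF.implicitFunction (by simp) hi, hF.implicitFunction_apply_self (by simp) hi,
    hF.contDiffAt_implicitFunction (by simp) hi, ?_⟩
  filter_upwards [hF.eventually_apply_implicitFunction (by simp) hi] with y hy
  exact hy.trans he

theorem exists_local_roots {t : Param} (ht : t ∈ Base) {e f : ℂ} (h : AreRoots t e f) :
    ∃ φ ψ : Param → ℂ, φ t = e ∧ ψ t = f ∧ ContDiffAt ℂ ω φ t ∧ ContDiffAt ℂ ω ψ t ∧
      ∀ᶠ y in 𝓝 t, AreRoots y (φ y) (ψ y) := by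
  obtain ⟨n1, n2, n3⟩ := h.ne ht
  obtain ⟨φ, h1, h2, h3⟩ := exists_local_root h.root (by
    rw [h.1, show 12 * e ^ 2 - 4 * (e ^ 2 + e * f + f ^ 2) = 4 * ((e - f) * (2 * e + f)) by ring]
    exact mul_ne_zero (by norm_num) (mul_ne_zero n1 n2))
  obtain ⟨ψ, k1, k2, k3⟩ := exists_local_root h.symm.root (by
    rw [h.1, show 12 * f ^ 2 - 4 * (e ^ 2 + e * f + f ^ 2) = -4 * ((e - f) * (e + 2 * f)) by ring]
    exact mul_ne_zero (by norm_num) (mul_ne_zero n1 n3))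
  refine ⟨φ, ψ, h1, k1, h2, k2, ?_⟩
  have hne : ∀ᶠ y in 𝓝 t, φ y - ψ y ≠ 0 :=
    (h2.continuousAt.sub k2.continuousAt).eventually_ne (by simpa [h1, k1] using n1)
  filter_upwards [h3, k3, hne] with y a1 a2 a3 using areRoots_of_ne a1 a2 a3

theorem eventually_contDiffAt_real {φ : Param → ℂ} {t : Param} (h : ContDiffAt ℂ ω φ t) :
    ∀ᶠ y in 𝓝 t, ContDiffAt ℝ ∞ φ y := by
  filter_upwards [h.eventually (by simp)] with y hy
  exact (hy.restrict_scalars ℝ).of_le (by simp)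

/-- A local family of loops through a given parameter, for a root `e` and the quotient `f/e`. -/
theorem exists_isRootFamily {t : Param} {φ ψ : Param → ℂ} (hφ : ContDiffAt ℂ ω φ t)
    (hψ : ContDiffAt ℂ ω ψ t) (hr : ∀ᶠ y in 𝓝 t, AreRoots y (φ y) (ψ y)) (ht : t ∈ Base)
    (h0 : φ t ≠ 0) (h1 : 1 - ψ t / φ t ∈ Complex.slitPlane)
    (h2 : 2 + ψ t / φ t ∈ Complex.slitPlane) {r : ℂ} (hr2 : r ^ 2 = φ t) :
    ∃ (W : Set Param) (ρ : Param → ℂ), t ∈ W ∧ W ⊆ Base ∧ ρ t = r ∧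
      IsRootFamily W t₂ t₃ φ ψ ρ := by
  have cφ := hφ.continuousAt
  have cψ := hψ.continuousAt
  have e0 : ∀ᶠ y in 𝓝 t, φ y ≠ 0 := cφ.eventually_ne h0
  have e1 : ∀ᶠ y in 𝓝 t, 1 - ψ y / φ y ∈ Complex.slitPlane :=
    (continuousAt_const.sub (cψ.div cφ h0)).eventually (Complex.isOpen_slitPlane.mem_nhds h1)
  have e2 : ∀ᶠ y in 𝓝 t, 2 + ψ y / φ y ∈ Complex.slitPlane :=
    (continuousAt_const.add (cψ.div cφ h0)).eventually (Complex.isOpen_slitPlane.mem_nhds h2)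
  have e3 : ∀ᶠ y in 𝓝 t, φ y / φ t ∈ Complex.slitPlane :=
    (cφ.div_const _).eventually (Complex.isOpen_slitPlane.mem_nhds (by simp [h0]))
  have e4 : ∀ᶠ y in 𝓝 t, y ∈ Base := isOpen_base.mem_nhds ht
  obtain ⟨W, hW, hWo, htW⟩ := eventually_nhds_iff.1 ((eventually_contDiffAt_real hφ).and
    ((eventually_contDiffAt_real hψ).and (hr.and (e0.and (e1.and (e2.and (e3.and e4)))))))
  choose! wφ wψ wr w0 w1 w2 w3 w4 using hW
  have sφ : ContDiffOn ℝ ∞ φ W := fun y hy => (wφ y hy).contDiffWithinAt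
  -- the branch of the square root of `φ` that takes the value `r` at `t`
  refine ⟨W, fun y => r * csqrt (φ y / φ t), htW, w4, ?_, ?_⟩
  · simp [h0, csqrt_one]
  exact
    { isOpen := hWo
      smooth_e := sφ
      smooth_f := fun y hy => (wψ y hy).contDiffWithinAt
      smooth_r := contDiffOn_const.mul (contDiffOn_csqrt (by
        simp only [div_eq_mul_inv]; exact sφ.mul contDiffOn_const) w3)
      smooth₂ := by unfold t₂; fun_prop
      smooth₃ := by unfold t₃ a b t₂; fun_prop
      eq₂ := fun y hy => (wr y hy).1
      eq₃ := fun y hy => (wr y hy).2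
      disc_ne := fun y hy => (w4 y hy).2.2
      ne_zero := w0
      sq_eq := fun y hy => by
        rw [mul_pow, csqrt_sq (div_ne_zero (w0 y hy) h0), hr2]
        field_simp
      mem₁ := w1
      mem₂ := w2 }

/-! ### Uniqueness of the Gauss-Manin matrix -/

/-- Two connection matrices with the defining property of the Gauss-Manin connection differ by a
matrix that annihilates all period vectors. -/
theorem sum_period_mul_sub {A : Param → Matrix (Fin 3) (Fin 3) (Param →L[ℂ] ℂ)}
    (hA : IsGaussManinMatrix A) {W : Set Param} (hW : IsOpen W) (hWB : W ⊆ Base)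
    {γ : Param → ℝ → ℂ × ℂ} (h : IsCycleFamily W γ) {t : Param} (ht : t ∈ W) (i : Fin 3)
    (τ : Param) : ∑ j, period j γ t * (A t i j τ - explicitMatrix t i j τ) = 0 := by
  have h1 := (hA.2 W hW hWB γ h t ht i).unique
    (isGaussManinMatrix_explicitMatrix.2 W hW hWB γ h t ht i)
  have h2 := congrArg (fun L : Param →L[ℂ] ℂ => L τ) h1
  simp only [Fin.sum_univ_three, add_apply, smul_apply, smul_eq_mul] at h2 ⊢
  linear_combination h2

theorem IsRootFamily.isCycleFamily {W : Set Param} {e f r : Param → ℂ}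
    (h : IsRootFamily W t₂ t₃ e f r) :
    IsCycleFamily W fun t s => (loopU (e t) s, loopV (r t) (f t / e t) s) := by
  refine ⟨h.isCurveFamily.smoothU.prodMk h.isCurveFamily.smoothV, h.isCurveFamily.curve,
    Or.inl fun t _ => ?_⟩
  obtain ⟨u0, v0⟩ := loop_end (r t) (f t / e t) (e t) (Or.inl rfl : (0 : ℝ) = 0 ∨ (0 : ℝ) = 1)
  obtain ⟨u1, v1⟩ := loop_end (r t) (f t / e t) (e t) (Or.inr rfl : (1 : ℝ) = 0 ∨ (1 : ℝ) = 1)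
  simp only [u0, v0, u1, v1]

theorem IsRootFamily.loop_relation {A : Param → Matrix (Fin 3) (Fin 3) (Param →L[ℂ] ℂ)}
    (hA : IsGaussManinMatrix A) {W : Set Param} (hWB : W ⊆ Base) {e f r : Param → ℂ}
    (h : IsRootFamily W t₂ t₃ e f r) {t : Param} (ht : t ∈ W) (i : Fin 3) (τ : Param) :
    loopInt₀ (r t) (f t / e t) * ((A t i 1 τ - explicitMatrix t i 1 τ) +
      t₁ t * (A t i 2 τ - explicitMatrix t i 2 τ)) =
    loopInt₁ (t₂ t) (t₃ t) (e t) (r t) (f t / e t) *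
      (A t i 2 τ - explicitMatrix t i 2 τ) := by
  have hs := sum_period_mul_sub hA h.isOpen hWB h.isCycleFamily ht i τ
  obtain ⟨p0, p1, p2⟩ := period_eq h.isOpen hWB h.isCycleFamily ht
  simp only [(h.integral_familyTheta ht).1, (h.integral_familyTheta ht).2] at p1 p2
  simp only [(loop_end 0 0 (e t) (Or.inl rfl)).1, (loop_end 0 0 (e t) (Or.inr rfl)).1] at p0 p2
  rw [Fin.sum_univ_three, p0, p1, p2] at hs
  linear_combination -hs

/-- The columns of a Gauss-Manin matrix that pair with the absolute periods are determined. -/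
theorem columns_eq {A : Param → Matrix (Fin 3) (Fin 3) (Param →L[ℂ] ℂ)}
    (hA : IsGaussManinMatrix A) {t : Param} (ht : t ∈ Base) (i : Fin 3) (τ : Param) :
    A t i 1 τ = explicitMatrix t i 1 τ ∧ A t i 2 τ = explicitMatrix t i 2 τ := by
  obtain ⟨e, f, h, h1, h2⟩ := exists_areRoots_ordered t
  obtain ⟨he, hl⟩ := h.ratio_mem ht h1 h2
  obtain ⟨hl0, s1, -, s3, s4⟩ := rootRegion_spec hl
  have hf : f ≠ 0 := fun h0 => hl0 (by simp [h0])
  rw [inv_div] at s3 s4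
  obtain ⟨φ, ψ, rfl, rfl, cφ, cψ, hr⟩ := exists_local_roots ht h
  obtain ⟨r, hr2⟩ := IsAlgClosed.exists_pow_nat_eq (φ t) (n := 2) (by norm_num)
  obtain ⟨r', hr2'⟩ := IsAlgClosed.exists_pow_nat_eq (ψ t) (n := 2) (by norm_num)
  obtain ⟨W, ρ, htW, hWB, rfl, hF⟩ := exists_isRootFamily cφ cψ hr ht he s1 hl.1 hr2
  obtain ⟨W', ρ', htW', hWB', rfl, hF'⟩ := exists_isRootFamily cψ cφ
    (by filter_upwards [hr] with y hy using hy.symm) ht hf s3 s4 hr2'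
  have k1 := hF.loop_relation hA hWB htW i τ
  have k2 := hF'.loop_relation hA hWB' htW' i τ
  have hdet := loopDet_ne_zero he hr2 hr2' hl
  rw [← h.1, ← h.2, loopDet] at hdet
  set X := A t i 1 τ - explicitMatrix t i 1 τ
  set Y := A t i 2 τ - explicitMatrix t i 2 τ
  have hY : Y = 0 := by
    apply mul_left_cancel₀ hdet
    linear_combination loopInt₀ (ρ' t) (φ t / ψ t) * k1 - loopInt₀ (ρ t) (ψ t / φ t) * k2
  have hX : X = 0 := by
    apply mul_left_cancel₀ hdet
    rw [hY] at k1 k2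
    linear_combination loopInt₁ (t₂ t) (t₃ t) (ψ t) (ρ' t) (φ t / ψ t) * k1 -
      loopInt₁ (t₂ t) (t₃ t) (φ t) (ρ t) (ψ t / φ t) * k2
  exact ⟨sub_eq_zero.1 hX, sub_eq_zero.1 hY⟩

/-- The product of the square roots of `1 - e_i σ/a` over the three roots `e_i`; the arguments are
`k = e/a` and `l = f/a`. -/
def segmentFactor (k l : ℂ) (σ : ℝ) : ℂ :=
  csqrt (1 - k * σ) * csqrt (1 - l * σ) * csqrt (1 - (-k - l) * σ)

theorem segmentFactor_ne_zero (k l : ℂ) (σ : ℝ) : segmentFactor k l σ ≠ 0 :=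
  mul_ne_zero (mul_ne_zero (csqrt_ne_zero _) (csqrt_ne_zero _)) (csqrt_ne_zero _)

theorem segmentFactor_sq {k l : ℂ} (h1 : 1 - k ∈ Complex.slitPlane)
    (h2 : 1 - l ∈ Complex.slitPlane) (h3 : 1 - (-k - l) ∈ Complex.slitPlane)
    {σ : ℝ} (s0 : 0 ≤ σ) (s1 : σ ≤ 1) :
    segmentFactor k l σ ^ 2 = (1 - k * σ) * (1 - l * σ) * (1 - (-k - l) * σ) := by
  rw [segmentFactor, mul_pow, mul_pow,
    csqrt_sq (Complex.slitPlane_ne_zero (one_sub_mul_mem_slitPlane h1 s0 s1)),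
    csqrt_sq (Complex.slitPlane_ne_zero (one_sub_mul_mem_slitPlane h2 s0 s1)),
    csqrt_sq (Complex.slitPlane_ne_zero (one_sub_mul_mem_slitPlane h3 s0 s1))]

theorem contDiffOn_segmentFactor {H : Type*} [NormedAddCommGroup H] [NormedSpace ℝ H] {Ω : Set H}
    {k l : H → ℂ} {σ : H → ℝ} (hk : ContDiffOn ℝ ∞ k Ω) (hl : ContDiffOn ℝ ∞ l Ω)
    (hσ : ContDiff ℝ ∞ σ) (h1 : ∀ z ∈ Ω, 1 - k z ∈ Complex.slitPlane)
    (h2 : ∀ z ∈ Ω, 1 - l z ∈ Complex.slitPlane)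
    (h3 : ∀ z ∈ Ω, 1 - (-k z - l z) ∈ Complex.slitPlane)
    (s0 : ∀ z, 0 ≤ σ z) (s1 : ∀ z, σ z ≤ 1) :
    ContDiffOn ℝ ∞ (fun z => segmentFactor (k z) (l z) (σ z)) Ω := by
  have hσ' : ContDiffOn ℝ ∞ (fun z => (σ z : ℂ)) Ω := (contDiff_ofReal hσ).contDiffOn
  exact ((contDiffOn_csqrt (by fun_prop) fun z hz =>
    one_sub_mul_mem_slitPlane (h1 z hz) (s0 z) (s1 z)).mul
    (contDiffOn_csqrt (by fun_prop) fun z hz =>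
    one_sub_mul_mem_slitPlane (h2 z hz) (s0 z) (s1 z))).mul
    (contDiffOn_csqrt (by fun_prop) fun z hz =>
    one_sub_mul_mem_slitPlane (h3 z hz) (s0 z) (s1 z))

/-- The path from `O` to `P` over the segment from `0` to `1/a`, for roots `e`, `f` and
`-(e + f)` of the cubic. The quotient of the square roots fixes the sign of `v` so that the path ends
at `P`; the sine keeps the parameter of the segment in `[0, 1]` for all real `s`. -/
def segmentPath (e f : Param → ℂ) (t : Param) (s : ℝ) : ℂ × ℂ :=
  ((Real.sin (Real.pi / 2 * s) ^ 2 : ℝ) / a t,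
    b t / a t ^ 2 * (Real.sin (Real.pi / 2 * s) : ℝ) *
      (segmentFactor (e t / a t) (f t / a t) (Real.sin (Real.pi / 2 * s) ^ 2) /
        segmentFactor (e t / a t) (f t / a t) 1))

/-- If no branch point lies on the segment from `0` to `1/a`, the first column of a Gauss-Manin
matrix is determined as well. -/
theorem column_zero_eq_of_segment {A : Param → Matrix (Fin 3) (Fin 3) (Param →L[ℂ] ℂ)}
    (hA : IsGaussManinMatrix A) {t : Param} (ht : t ∈ Base) {e f : ℂ} (h : AreRoots t e f)
    (h1 : 1 - e / a t ∈ Complex.slitPlane) (h2 : 1 - f / a t ∈ Complex.slitPlane)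
    (h3 : 1 - (-(e / a t) - f / a t) ∈ Complex.slitPlane) (i : Fin 3) (τ : Param) :
    A t i 0 τ = explicitMatrix t i 0 τ := by
  obtain ⟨φ, ψ, rfl, rfl, cφ, cψ, hr⟩ := exists_local_roots ht h
  have ca : ContinuousAt a t := (continuous_apply 0).continuousAt
  have d1 := cφ.continuousAt.div ca ht.1
  have d2 := cψ.continuousAt.div ca ht.1
  have e1 : ∀ᶠ y in 𝓝 t, 1 - φ y / a y ∈ Complex.slitPlane :=
    (continuousAt_const.sub d1).eventually (Complex.isOpen_slitPlane.mem_nhds h1)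
  have e2 : ∀ᶠ y in 𝓝 t, 1 - ψ y / a y ∈ Complex.slitPlane :=
    (continuousAt_const.sub d2).eventually (Complex.isOpen_slitPlane.mem_nhds h2)
  have e3 : ∀ᶠ y in 𝓝 t, 1 - (-(φ y / a y) - ψ y / a y) ∈ Complex.slitPlane :=
    (continuousAt_const.sub (d1.neg.sub d2)).eventually (Complex.isOpen_slitPlane.mem_nhds h3)
  have e4 : ∀ᶠ y in 𝓝 t, y ∈ Base := isOpen_base.mem_nhds ht
  obtain ⟨W, hW, hWo, htW⟩ := eventually_nhds_iff.1 ((eventually_contDiffAt_real cφ).and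
    ((eventually_contDiffAt_real cψ).and (hr.and (e1.and (e2.and (e3.and e4))))))
  choose! wφ wψ wr w1 w2 w3 w4 using hW
  have sa : ContDiff ℝ ∞ fun z : Param × ℝ => a z.1 := by unfold a; fun_prop
  have sb : ContDiff ℝ ∞ fun z : Param × ℝ => b z.1 := by unfold b; fun_prop
  have sai : ContDiffOn ℝ ∞ (fun z : Param × ℝ => (a z.1)⁻¹) (W ×ˢ Set.univ) :=
    sa.contDiffOn.inv fun z hz => (w4 z.1 hz.1).1
  have sk : ContDiffOn ℝ ∞ (fun z : Param × ℝ => φ z.1 / a z.1) (W ×ˢ Set.univ) := by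
    simp only [div_eq_mul_inv]
    exact ContDiffOn.mul (ContDiffOn.comp (t := W) (fun y hy => (wφ y hy).contDiffWithinAt)
      contDiffOn_fst fun _ hz => hz.1) sai
  have sl : ContDiffOn ℝ ∞ (fun z : Param × ℝ => ψ z.1 / a z.1) (W ×ˢ Set.univ) := by
    simp only [div_eq_mul_inv]
    exact ContDiffOn.mul (ContDiffOn.comp (t := W) (fun y hy => (wψ y hy).contDiffWithinAt)
      contDiffOn_fst fun _ hz => hz.1) sai
  have hsq : ∀ s : ℝ, 0 ≤ Real.sin (Real.pi / 2 * s) ^ 2 ∧ Real.sin (Real.pi / 2 * s) ^ 2 ≤ 1 :=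
    fun s => ⟨sq_nonneg _, Real.sin_sq_le_one _⟩
  have hs0 : ∀ y, segmentPath φ ψ y 0 = ptO := fun y => by simp [segmentPath, ptO]
  have hs1 : ∀ y, segmentPath φ ψ y 1 = ptP y := fun y => by
    simp [segmentPath, ptP, segmentFactor_ne_zero]
  have hcyc : IsCycleFamily W (segmentPath φ ψ) := by
    refine ⟨ContDiffOn.prodMk ?_ ?_, ?_, Or.inr ⟨Or.inl fun y _ => hs0 y, Or.inr fun y _ => hs1 y⟩⟩
    · have hs : ContDiff ℝ ∞ fun z : Param × ℝ => ((Real.sin (Real.pi / 2 * z.2) ^ 2 : ℝ) : ℂ) :=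
        contDiff_ofReal (by fun_prop)
      simp only [div_eq_mul_inv (_ : ℂ) (a _)]
      exact hs.contDiffOn.mul sai
    · have hs : ContDiff ℝ ∞ fun z : Param × ℝ => ((Real.sin (Real.pi / 2 * z.2) : ℝ) : ℂ) :=
        contDiff_ofReal (by fun_prop)
      have f1 := contDiffOn_segmentFactor sk sl
        (σ := fun z : Param × ℝ => Real.sin (Real.pi / 2 * z.2) ^ 2) (by fun_prop)
        (fun z hz => w1 z.1 hz.1) (fun z hz => w2 z.1 hz.1) (fun z hz => w3 z.1 hz.1)
        (fun z => (hsq z.2).1) (fun z => (hsq z.2).2)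
      have f2 := contDiffOn_segmentFactor sk sl (σ := fun _ : Param × ℝ => 1) contDiff_const
        (fun z hz => w1 z.1 hz.1) (fun z hz => w2 z.1 hz.1) (fun z hz => w3 z.1 hz.1)
        (fun _ => zero_le_one) (fun _ => le_rfl)
      have f3 := f2.inv fun z _ => segmentFactor_ne_zero _ _ _
      have := ((sb.contDiffOn.mul (sai.pow 2)).mul hs.contDiffOn).mul (f1.mul f3)
      refine this.congr fun z _ => ?_
      simp only [div_eq_mul_inv, inv_pow, Pi.inv_apply]
    · intro y hy s _
      have ha : a y ≠ 0 := (w4 y hy).1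
      have hb : b y ≠ 0 := (w4 y hy).2.1
      have hR := wr y hy
      have hb2 : b y ^ 2 = 4 * a y ^ 3 * ((1 - φ y / a y * (1 : ℝ)) * (1 - ψ y / a y * (1 : ℝ)) *
          (1 - (-(φ y / a y) - ψ y / a y) * (1 : ℝ))) := by
        have : b y ^ 2 = 4 * a y ^ 3 - t₂ y * a y - t₃ y := by rw [t₃]; ring
        rw [this, hR.1, hR.2]
        push_cast
        field_simp
        ring
      have hF := segmentFactor_sq (w1 y hy) (w2 y hy) (w3 y hy) zero_le_one le_rfl
      rw [← hF] at hb2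
      have hF0 := segmentFactor_ne_zero (φ y / a y) (ψ y / a y) 1
      change (b y / a y ^ 2 * (Real.sin (Real.pi / 2 * s) : ℝ) *
        (segmentFactor (φ y / a y) (ψ y / a y) (Real.sin (Real.pi / 2 * s) ^ 2) /
        segmentFactor (φ y / a y) (ψ y / a y) 1)) ^ 2 =
        quartic y ((Real.sin (Real.pi / 2 * s) ^ 2 : ℝ) / a y)
      rw [mul_pow, mul_pow, div_pow, div_pow,
        segmentFactor_sq (w1 y hy) (w2 y hy) (w3 y hy) (hsq s).1 (hsq s).2, hb2, quartic, hR.1,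
        hR.2]
      push_cast
      field_simp
      ring
  have hs := sum_period_mul_sub hA hWo w4 hcyc htW i τ
  obtain ⟨p0, -, -⟩ := period_eq hWo w4 hcyc htW
  obtain ⟨c1, c2⟩ := columns_eq hA ht i τ
  -- `α₁` has period `-1`, and only the entry of the first column remains
  have hp : period 0 (segmentPath φ ψ) t = -1 := by
    rw [p0, hs0, hs1, ptO, ptP]
    have := ht.1
    field_simp
    simp
  rw [Fin.sum_univ_three, hp, c1, c2] at hs
  linear_combination -hs

/-- A half-line `[1, ∞)` is left by an arbitrarily small rotation. -/
theorem eventually_one_sub_mul_exp_mem (l : ℂ) : ∀ᶠ ε : ℝ in 𝓝[>] 0,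
    1 - l * Complex.exp (-(ε * Complex.I)) ∈ Complex.slitPlane := by
  by_cases hl : 1 - l ∈ Complex.slitPlane
  · have hc : ContinuousAt (fun ε : ℝ => 1 - l * Complex.exp (-(ε * Complex.I))) 0 := by fun_prop
    refine (hc.eventually (Complex.isOpen_slitPlane.mem_nhds ?_)).filter_mono nhdsWithin_le_nhds
    simpa using hl
  · simp only [Complex.mem_slitPlane_iff, not_or, not_lt, not_not] at hl
    obtain ⟨x, rfl⟩ : ∃ x : ℝ, l = x := ⟨l.re, Complex.ext rfl (by simpa using hl.2)⟩
    have hx : 1 ≤ x := by simpa using hl.1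
    filter_upwards [Ioo_mem_nhdsGT Real.pi_pos] with ε hε
    rw [Complex.mem_slitPlane_iff]
    right
    have hs := Real.sin_pos_of_pos_of_lt_pi hε.1 hε.2
    simp [Complex.exp_im]
    constructor
    · linarith
    · exact hs.ne'

/-- The point obtained from `t` by rotating `a`, with `t₂` and `t₃` fixed. -/
def rotate (t : Param) (ε : ℝ) : Param :=
  let a' := a t * Complex.exp (ε * Complex.I)
  ![a', b t * csqrt ((4 * a' ^ 3 - t₂ t * a' - t₃ t) / b t ^ 2), c t, t₁ t, t₂ t]

theorem rotate_zero {t : Param} (ht : t ∈ Base) : rotate t 0 = t := by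
  have hb : b t ≠ 0 := ht.2.1
  have h : 4 * a t ^ 3 - t₂ t * a t - t₃ t = b t ^ 2 := by rw [t₃]; ring
  have e0 : a t * Complex.exp ((0 : ℝ) * Complex.I) = a t := by simp
  refine funext fun i => ?_
  fin_cases i
  · exact e0
  · change b t * csqrt ((4 * (a t * Complex.exp ((0 : ℝ) * Complex.I)) ^ 3 -
      t₂ t * (a t * Complex.exp ((0 : ℝ) * Complex.I)) - t₃ t) / b t ^ 2) = b t
    rw [e0, h, div_self (pow_ne_zero 2 hb), csqrt_one, mul_one]
  · rfl
  · rfl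
  · rfl

theorem continuousAt_rotate {t : Param} (ht : t ∈ Base) : ContinuousAt (rotate t) 0 := by
  have hb : b t ≠ 0 := ht.2.1
  have h : 4 * a t ^ 3 - t₂ t * a t - t₃ t = b t ^ 2 := by rw [t₃]; ring
  have hc : ContinuousAt (fun ε : ℝ => (4 * (a t * Complex.exp (ε * Complex.I)) ^ 3 -
      t₂ t * (a t * Complex.exp (ε * Complex.I)) - t₃ t) / b t ^ 2) 0 := by fun_prop
  have hs : ContinuousAt csqrt ((4 * (a t * Complex.exp ((0 : ℝ) * Complex.I)) ^ 3 -
      t₂ t * (a t * Complex.exp ((0 : ℝ) * Complex.I)) - t₃ t) / b t ^ 2) :=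
    (contDiffAt_csqrt (by simp [h, hb])).continuousAt
  rw [continuousAt_pi]
  intro i
  fin_cases i
  · change ContinuousAt (fun ε : ℝ => a t * Complex.exp (ε * Complex.I)) 0
    fun_prop
  · exact continuousAt_const.mul (ContinuousAt.comp (g := csqrt) hs hc)
  · exact continuousAt_const
  · exact continuousAt_const
  · exact continuousAt_const

theorem t₃_rotate {t : Param} (ht : t ∈ Base) :
    ∀ᶠ ε : ℝ in 𝓝 0, t₃ (rotate t ε) = t₃ t := by
  have hb : b t ≠ 0 := ht.2.1
  have h : 4 * a t ^ 3 - t₂ t * a t - t₃ t = b t ^ 2 := by rw [t₃]; ring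
  have hc : ContinuousAt (fun ε : ℝ => (4 * (a t * Complex.exp (ε * Complex.I)) ^ 3 -
      t₂ t * (a t * Complex.exp (ε * Complex.I)) - t₃ t) / b t ^ 2) 0 := by fun_prop
  filter_upwards [hc.eventually_ne (by simp [h, hb] : _ ≠ (0 : ℂ))] with ε hε
  change 4 * (a t * Complex.exp (ε * Complex.I)) ^ 3 - t₂ t * (a t * Complex.exp (ε * Complex.I)) -
    (b t * csqrt ((4 * (a t * Complex.exp (ε * Complex.I)) ^ 3 -
      t₂ t * (a t * Complex.exp (ε * Complex.I)) - t₃ t) / b t ^ 2)) ^ 2 = t₃ t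
  generalize a t * Complex.exp (ε * Complex.I) = x at hε ⊢
  rw [mul_pow, csqrt_sq hε]
  field_simp
  ring

/-- The first column of a Gauss-Manin matrix is determined: by continuity it suffices to consider
the parameters for which the segment from `O` to `P` avoids the branch points. -/
theorem column_zero_eq {A : Param → Matrix (Fin 3) (Fin 3) (Param →L[ℂ] ℂ)}
    (hA : IsGaussManinMatrix A) {t : Param} (ht : t ∈ Base) (i : Fin 3) (τ : Param) :
    A t i 0 τ = explicitMatrix t i 0 τ := by
  have hcont : ∀ B, IsGaussManinMatrix B → Filter.Tendsto (fun ε : ℝ => B (rotate t ε) i 0 τ)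
      (𝓝[>] 0) (𝓝 (B t i 0 τ)) := by
    intro B hB
    have h1 : ContinuousAt (fun t => B t i 0 τ) t :=
      (((hB.1 i 0).continuousOn.continuousAt (isOpen_base.mem_nhds ht)).clm_apply
        continuousAt_const)
    have h2 := (continuousAt_rotate ht).tendsto
    rw [rotate_zero ht] at h2
    exact (h1.tendsto.comp h2).mono_left nhdsWithin_le_nhds
  obtain ⟨e, f, h⟩ := exists_areRoots t
  have hB : ∀ᶠ ε : ℝ in 𝓝 0, rotate t ε ∈ Base := by
    refine (continuousAt_rotate ht).eventually (isOpen_base.mem_nhds ?_)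
    rwa [rotate_zero ht]
  refine tendsto_nhds_unique_of_eventuallyEq (hcont A hA)
    (hcont explicitMatrix isGaussManinMatrix_explicitMatrix) ?_
  filter_upwards [hB.filter_mono nhdsWithin_le_nhds,
    (t₃_rotate ht).filter_mono nhdsWithin_le_nhds, eventually_one_sub_mul_exp_mem (e / a t),
    eventually_one_sub_mul_exp_mem (f / a t),
    eventually_one_sub_mul_exp_mem (-(e / a t) - f / a t)] with ε k1 k2 k3 k4 k5
  have hdiv : ∀ x : ℂ, x / a (rotate t ε) = x / a t * Complex.exp (-(ε * Complex.I)) := by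
    intro x
    change x / (a t * Complex.exp (ε * Complex.I)) = _
    rw [Complex.exp_neg, ← div_div]
    rfl
  refine column_zero_eq_of_segment hA k1 (e := e) (f := f) ⟨h.1, k2.trans h.2⟩ ?_ ?_ ?_ i τ
  · rwa [hdiv]
  · rwa [hdiv]
  · rw [hdiv, hdiv]
    convert k5 using 1
    ring

end EllipticPair

end

theorem mainTheorem6 :
    EllipticPair.IsGaussManinMatrix EllipticPair.explicitMatrix ∧
    ∀ A : EllipticPair.Param → Matrix (Fin 3) (Fin 3) (EllipticPair.Param →L[ℂ] ℂ),
      EllipticPair.IsGaussManinMatrix A →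
        ∀ t ∈ EllipticPair.Base, A t = EllipticPair.explicitMatrix t := by
  refine ⟨EllipticPair.isGaussManinMatrix_explicitMatrix, fun A hA t ht => ?_⟩
  ext i j τ
  fin_cases j
  · exact EllipticPair.column_zero_eq hA ht i τ
  · exact (EllipticPair.columns_eq hA ht i τ).1
  · exact (EllipticPair.columns_eq hA ht i τ).2
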